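/- Let $q\ge 6$ be an integer. For $H\in(0,1)$ let $B_H=(B_H(t))_{t\in\mathbb R}$ be a fractional Brownian motion with Hurst index $H$, i.e. a centered Gaussian process with continuous paths and covariance $E[B_H(t)B_H(s)]=\frac12\big(|t|^{2H}+|s|^{2H}-|t-s|^{2H}\big)$. Put $X_k=B_H(k+1)-B_H(k)$ for $k\in\mathbb Z$ and, for $n\ge 1$, $$V_n=\frac1{\sqrt n}\sum_{k=0}^{n-1}H_q(X_k),\qquad v_n=E[V_n^2],\qquad F_n=\frac{V_n}{\sqrt{v_n}},$$ where $H_q(x)=(-1)^q e^{x^2/2}\frac{d^q}{dx^q}e^{-x^2/2}$ is the $q$-th Hermite polynomial. Let $\kappa_j(F)=(-i)^j\frac{d^j}{dt^j}\log E[e^{itF}]\big|_{t=0}$ denote the $j$-th cumulant of a random variable $F$. (1) There is a non-empty open interval $(a,b)\subset\big(0,1-\frac1{2q}\big)$, depending only on $q$, such that for every $H\in(a,b)$ one has $\kappa_3(F_n)\to0$ and $\kappa_4(F_n)\to0$ as $n\to\infty$, $\kappa_4(F_n)>0$ for all $n\ge1$, and $\kappa_3(F_n)=o(\kappa_4(F_n))$;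 that is, $\kappa_4(F_n)$ tends to $0$ more slowly than $\kappa_3(F_n)$. (2) If moreover $q$ is even, there is also a non-empty open interval $(a',b')\subset\big(0,1-\frac1{2q}\big)$, depending only on $q$, such that for every $H\in(a',b')$ one has $\kappa_3(F_n)\to0$ and $\kappa_4(F_n)\to0$, $\kappa_3(F_n)>0$ for all $n\ge1$, and $\kappa_4(F_n)=o(\kappa_3(F_n))$. In particular, either one of the two cumulants can be the dominant term of $\max\{|\kappa_3(F_n)|,\kappa_4(F_n)\}$. -/

import Mathlib

open MeasureTheory ProbabilityTheory Filter Topology Asymptotics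

noncomputable section

/-- `B` is a (two-sided) fractional Brownian motion with Hurst index `H` under `P`: a centered
Gaussian process indexed by `ℝ`, with (almost surely) continuous paths and covariance
`E[B(t) B(s)] = (|t|^{2H} + |s|^{2H} - |t - s|^{2H}) / 2`. -/
structure IsFractionalBrownianMotion {Ω : Type*} [MeasurableSpace Ω] (H : ℝ) (B : ℝ → Ω → ℝ)
    (P : Measure Ω) : Prop where
  gaussian : IsGaussianProcess B P
  centered : ∀ t : ℝ, ∫ ω, B t ω ∂P = 0
  covariance : ∀ t s : ℝ,
    ∫ ω, B t ω * B s ω ∂P = (|t| ^ (2 * H) + |s| ^ (2 * H) - |t - s| ^ (2 * H)) / 2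
  continuous_paths : ∀ᵐ ω ∂P, Continuous fun t : ℝ => B t ω

/-- The unit increments `X_k = B(k+1) - B(k)`, `k ∈ ℤ`. When `B` is a fractional Brownian motion
this is fractional Gaussian noise. -/
def unitIncrement {Ω : Type*} (B : ℝ → Ω → ℝ) (k : ℤ) (ω : Ω) : ℝ :=
  B ((k : ℝ) + 1) ω - B (k : ℝ) ω

/-- `V_n = n^{-1/2} ∑_{k=0}^{n-1} H_q(X_k)`, where `H_q` is the `q`-th (probabilists', monic)
Hermite polynomial. -/
def hermiteSum {Ω : Type*} (q : ℕ) (X : ℤ → Ω → ℝ) (n : ℕ) (ω : Ω) : ℝ :=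
  (1 / √(n : ℝ)) *
    ∑ k ∈ Finset.range n, Polynomial.aeval (X (k : ℤ) ω) (Polynomial.hermite q)

/-- `F_n = V_n / √v_n` with `v_n = E[V_n ^ 2]`. -/
def normalizedHermiteSum {Ω : Type*} [MeasurableSpace Ω] (P : Measure Ω) (q : ℕ)
    (X : ℤ → Ω → ℝ) (n : ℕ) (ω : Ω) : ℝ :=
  hermiteSum q X n ω / √(∫ ω', (hermiteSum q X n ω') ^ 2 ∂P)

/-- The `j`-th cumulant `κ_j(F) = (-i)^j (d/dt)^j log E[exp(i t F)]` at `t = 0` of a real random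
variable `F` with a finite moment of order `j`. This complex number is real, and we take its real
part in order to land in `ℝ`. -/
def cumulant {Ω : Type*} [MeasurableSpace Ω] (P : Measure Ω) (j : ℕ) (F : Ω → ℝ) : ℝ :=
  ((-Complex.I) ^ j *
    iteratedDeriv j (fun t : ℝ => Complex.log (charFun (P.map F) t)) 0).re

/-- The `j`-th cumulant of `F_n`, for the Hermite sums of order `q` of the unit increments
of `B`. -/
def noiseCumulant {Ω : Type*} [MeasurableSpace Ω] (P : Measure Ω) (q : ℕ) (B : ℝ → Ω → ℝ)
    (j n : ℕ) : ℝ :=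
  cumulant P j (normalizedHermiteSum P q (unitIncrement B) n)

end

/-! ### Hermite polynomials and Gaussian integration by parts -/

/-! For `H > 1/2` the noise covariance `ρ` is strictly positive, so sums of products of covariances
can be bounded from both sides without cancellation. Moments of the Hermite sum are computed by
Gaussian integration by parts (`integral_four_eq_sum`): regress the other variables on one of them
and differentiate.

The variance of the unnormalised sum is `q! ∑ ρ(i-j)^q`, of order `n`. The third moment vanishes for
odd `q`; for even `q` it is a constant times a sum over triangles of `ρ^(q/2)`. The diagonal gives
the lower bound `n`, and AM-GM (`triple_pow_le`) gives the upper bound `O(n)` when `∑ ρ^(3q/4)`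
converges. Thus the third cumulant has order `n^(-1/2)`, or is zero.

In the fourth moment, a polynomial with nonnegative coefficients in the three pairings, the pure
powers sum exactly to three times the squared variance (`three_mul_variance_sq`). The mixed
monomials are dominated by the form `x^(q-1) y`, which itself occurs. When `∑ ρ^(q-1)` converges,
this makes the fourth cumulant comparable to `n⁻² ∑ ρ(i-k)²` (`sum_sq_le_fourth_cumulant`,
`fourth_cumulant_le`). These estimates are combined in `noiseCumulant_bounds`.

It remains to compare rates. The double sum is at least of order `n^(4H-2)`, so for `H > 7/8` the
fourth cumulant is at least of order `n^(4H-4)`, which beats `n^(-1/2)`. For `H < 3/4` the squares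
are summable and the fourth cumulant is `O(1/n)`, which loses to `n^(-1/2)`. Both summability
conditions hold when `H < 1 - 2/(3q)`, a bound that exceeds `7/8` exactly from `q = 6` on. -/

open Polynomial in
/-- The probabilists' Hermite polynomial with real coefficients. -/
noncomputable def realHermite (n : ℕ) : Polynomial ℝ := (hermite n).map (Int.castRingHom ℝ)

open Polynomial in
lemma aeval_hermite_eq_eval (n : ℕ) (x : ℝ) : aeval x (hermite n) = (realHermite n).eval x := by
  rw [realHermite, eval_map, aeval_def]
  rfl

open Polynomial in
@[simp]
lemma realHermite_zero : realHermite 0 = 1 := by simp [realHermite]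

open Polynomial in
lemma realHermite_succ (n : ℕ) :
    realHermite (n + 1) = X * realHermite n - derivative (realHermite n) := by
  simp [realHermite, hermite_succ, derivative_map]

open Polynomial in
lemma derivative_realHermite_succ (n : ℕ) :
    derivative (realHermite (n + 1)) = C ((n : ℝ) + 1) * realHermite n := by
  induction n with
  | zero => simp [realHermite_succ]
  | succ n ih =>
    rw [realHermite_succ (n + 1), derivative_sub, derivative_mul, ih, derivative_mul]
    rw [realHermite_succ n]
    simp only [derivative_X, derivative_C, derivative_one, Nat.cast_add,
      Nat.cast_one, map_add, map_one]
    ring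

open Polynomial in
lemma derivative_realHermite (n : ℕ) :
    derivative (realHermite n) = C (n : ℝ) * realHermite (n - 1) := by
  cases n with
  | zero => simp
  | succ n => simpa using derivative_realHermite_succ n

-- The affine argument is the regression of one Gaussian variable on another. For `i > b` the
-- falling factorial vanishes, so the truncated index `b - i` does no harm.
open Polynomial in
lemma iterate_derivative_realHermite_comp (b i : ℕ) (r y : ℝ) :
    derivative^[i] ((realHermite b).comp (C r * X + C y)) =
      C (r ^ i * (b.descFactorial i : ℝ)) * (realHermite (b - i)).comp (C r * X + C y) := by
  induction i with
  | zero => simp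
  | succ i ih =>
    rw [Function.iterate_succ_apply', ih, derivative_C_mul, derivative_comp,
      derivative_realHermite, Nat.descFactorial_succ, Nat.sub_sub]
    simp only [derivative_add, derivative_mul, derivative_C, derivative_X, mul_comp, C_comp,
      map_mul, map_pow, Nat.cast_mul]
    ring

lemma integrable_eval_gaussianReal (p : Polynomial ℝ) :
    Integrable (fun x => p.eval x) (gaussianReal 0 1) := by
  induction p using Polynomial.induction_on' with
  | add p q hp hq => 
    refine (hp.add hq).congr (ae_of_all _ fun x => ?_)
    simp
  | monomial n a =>
    simp only [Polynomial.eval_monomial]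
    refine Integrable.const_mul ?_ a
    have := (memLp_id_gaussianReal' (μ := 0) (v := 1) (n : ENNReal) (by simp)).integrable_norm_pow'
    refine this.mono' (by fun_prop) (ae_of_all _ fun x => ?_)
    simp

lemma hasDerivAt_gaussianPDFReal_standard (x : ℝ) :
    HasDerivAt (gaussianPDFReal 0 1) (-x * gaussianPDFReal 0 1 x) x := by
  have h : HasDerivAt (fun y : ℝ => (√(2 * Real.pi * ((1 : NNReal) : ℝ)))⁻¹ *
      Real.exp (-(y - 0) ^ 2 / (2 * ((1 : NNReal) : ℝ))))
      (-x * ((√(2 * Real.pi * ((1 : NNReal) : ℝ)))⁻¹ *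
        Real.exp (-(x - 0) ^ 2 / (2 * ((1 : NNReal) : ℝ))))) x := by
    have h1 : HasDerivAt (fun y : ℝ => -(y - 0) ^ 2 / (2 * ((1 : NNReal) : ℝ))) (-x) x := by
      have := (((hasDerivAt_id x).sub_const 0).pow 2).neg.div_const (2 * ((1 : NNReal) : ℝ))
      convert! this using 1
      simp only [id_eq, sub_zero, NNReal.coe_one, Nat.cast_ofNat]
      ring
    convert! h1.exp.const_mul (√(2 * Real.pi * ((1 : NNReal) : ℝ)))⁻¹ using 1
    ring
  exact h

open Polynomial in
/-- Stein's identity for polynomials under the standard Gaussian law. -/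
lemma integral_id_mul_eval_gaussianReal (p : Polynomial ℝ) :
    ∫ x, x * p.eval x ∂(gaussianReal 0 1) =
      ∫ x, (derivative p).eval x ∂(gaussianReal 0 1) := by
  have hint (p : Polynomial ℝ) :
      Integrable (fun x => gaussianPDFReal 0 1 x * p.eval x) := by
    have h := integrable_eval_gaussianReal p
    rw [gaussianReal_of_var_ne_zero _ one_ne_zero,
      integrable_withDensity_iff_integrable_smul' (by fun_prop) (by simp [gaussianPDF])] at h
    simpa [toReal_gaussianPDF] using h
  -- The integrand is the derivative of density times `p`, and both functions are integrable, so the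
  -- integral over the line is zero.
  have key : ∫ x, (gaussianPDFReal 0 1 x * (derivative p).eval x
      - gaussianPDFReal 0 1 x * (X * p).eval x) = 0 := by
    refine integral_eq_zero_of_hasDerivAt_of_integrable
      (f := fun x => gaussianPDFReal 0 1 x * p.eval x) (fun x => ?_)
      ((hint _).sub (hint _)) (hint _)
    convert! (hasDerivAt_gaussianPDFReal_standard x).mul (p.hasDerivAt x) using 1
    simp; ring
  rw [integral_sub (hint _) (hint _), sub_eq_zero] at key
  simp_rw [integral_gaussianReal_eq_integral_smul one_ne_zero, smul_eq_mul]
  rw [key]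
  simp

-- Stein's identity for `realHermite a * p` produces the term with the derivative of `realHermite
-- a`, which the Hermite recursion subtracts; what is left has one derivative moved to `p`.
open Polynomial in
lemma integral_realHermite_mul_eval_gaussianReal (a : ℕ) (p : Polynomial ℝ) :
    ∫ x, (realHermite a).eval x * p.eval x ∂(gaussianReal 0 1) =
      ∫ x, (derivative^[a] p).eval x ∂(gaussianReal 0 1) := by
  induction a generalizing p with
  | zero => simp
  | succ a ih =>
    rw [Function.iterate_succ_apply, ← ih, realHermite_succ]
    have h := integral_id_mul_eval_gaussianReal (realHermite a * p)
    have h1 : ∀ x : ℝ, (X * realHermite a - derivative (realHermite a)).eval x * p.eval x =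
        x * (realHermite a * p).eval x - (derivative (realHermite a) * p).eval x := by
      intro x; simp; ring
    simp_rw [h1]
    rw [integral_sub, h, ← integral_sub]
    · congr 1; ext x; simp
    · exact integrable_eval_gaussianReal _
    · exact integrable_eval_gaussianReal _
    · refine (integrable_eval_gaussianReal (X * (realHermite a * p))).congr
        (ae_of_all _ fun x => ?_)
      simp
    · exact integrable_eval_gaussianReal _

open Polynomial in
/-- Integration by parts in one standard Gaussian coordinate, conditionally on an independent
family `Y`. -/
lemma IndepFun.integral_realHermite_mul {Ω E : Type*} [MeasurableSpace Ω] [TopologicalSpace E]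
    [MeasurableSpace E] [BorelSpace E] [SecondCountableTopology E]
    {P : Measure Ω} [IsProbabilityMeasure P] {U : Ω → ℝ} {Y : Ω → E}
    (hU : AEMeasurable U P) (hY : AEMeasurable Y P)
    (hUY : IndepFun U Y P) (hlaw : P.map U = gaussianReal 0 1) (a : ℕ) (K : E → Polynomial ℝ)
    (hK : Continuous fun z : ℝ × E => (K z.2).eval z.1)
    (hK' : Continuous fun z : ℝ × E => (derivative^[a] (K z.2)).eval z.1)
    (hint : Integrable (fun ω => (realHermite a).eval (U ω) * (K (Y ω)).eval (U ω)) P)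
    (hint' : Integrable (fun ω => (derivative^[a] (K (Y ω))).eval (U ω)) P) :
    ∫ ω, (realHermite a).eval (U ω) * (K (Y ω)).eval (U ω) ∂P =
      ∫ ω, (derivative^[a] (K (Y ω))).eval (U ω) ∂P := by
  have hmap := (indepFun_iff_map_prod_eq_prod_map_map hU hY).1 hUY
  have hUY' : AEMeasurable (fun ω => (U ω, Y ω)) P := hU.prodMk hY
  have : IsProbabilityMeasure (P.map Y) := Measure.isProbabilityMeasure_map hY
  have hc : Continuous fun z : ℝ × E => (realHermite a).eval z.1 * (K z.2).eval z.1 :=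
    ((realHermite a).continuous.comp continuous_fst).mul hK
  have hm := hc.aestronglyMeasurable (μ := P.map fun ω => (U ω, Y ω))
  have hm' := hK'.aestronglyMeasurable (μ := P.map fun ω => (U ω, Y ω))
  have e1 := integral_map hUY' hm
  have e2 := integral_map hUY' hm'
  have i1 := (integrable_map_measure hm hUY').2 hint
  have i2 := (integrable_map_measure hm' hUY').2 hint'
  rw [← e1, ← e2]
  rw [hmap, hlaw] at i1 i2 ⊢
  -- Independence makes the joint law a product, so Fubini reduces the claim to the one-dimensional
  -- identity for each frozen `y`.
  rw [integral_prod_symm _ i1, integral_prod_symm _ i2]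
  congr 1
  ext y
  exact integral_realHermite_mul_eval_gaussianReal a (K y)

/-! ### Random variables with moments of all orders -/

/-- The random variable `f` has finite moments of all orders. -/
def HasAllMoments {Ω : Type*} [MeasurableSpace Ω] (f : Ω → ℝ) (P : Measure Ω) : Prop :=
  ∀ m : ℕ, MemLp f m P

namespace HasAllMoments

variable {Ω : Type*} [MeasurableSpace Ω] {P : Measure Ω} {f g : Ω → ℝ}

lemma integrable [IsFiniteMeasure P] (hf : HasAllMoments f P) : Integrable f P := by
  have := hf 1
  rw [Nat.cast_one] at this
  exact memLp_one_iff_integrable.1 this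

lemma memLp_two (hf : HasAllMoments f P) : MemLp f 2 P := by
  simpa using hf 2

lemma const [IsFiniteMeasure P] (c : ℝ) : HasAllMoments (fun _ : Ω => c) P :=
  fun _ => memLp_const c

lemma add (hf : HasAllMoments f P) (hg : HasAllMoments g P) :
    HasAllMoments (fun ω => f ω + g ω) P :=
  fun m => (hf m).add (hg m)

lemma const_mul (hf : HasAllMoments f P) (c : ℝ) : HasAllMoments (fun ω => c * f ω) P :=
  fun m => (hf m).const_mul c

lemma mul [IsFiniteMeasure P] (hf : HasAllMoments f P) (hg : HasAllMoments g P) :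
    HasAllMoments (fun ω => f ω * g ω) P := by
  intro m
  -- Cauchy–Schwarz: two factors in `L^(2m)` have product in `L^m`.
  have : ENNReal.HolderTriple ((2 * m : ℕ) : ENNReal) ((2 * m : ℕ) : ENNReal) (m : ENNReal) := by
    constructor
    rcases Nat.eq_zero_or_pos m with rfl | hm
    · simp
    · rw [Nat.cast_mul, ENNReal.mul_inv (by simp) (by simp), ← add_mul]
      simp [ENNReal.inv_two_add_inv_two]
  exact MemLp.mul' (hg (2 * m)) (hf (2 * m))

lemma pow [IsFiniteMeasure P] (hf : HasAllMoments f P) (n : ℕ) :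
    HasAllMoments (fun ω => f ω ^ n) P := by
  induction n with
  | zero => simpa using const 1
  | succ n ih => simpa only [pow_succ] using ih.mul hf

lemma finset_sum {ι : Type*} {F : ι → Ω → ℝ} (s : Finset ι)
    (hF : ∀ i ∈ s, HasAllMoments (F i) P) : HasAllMoments (fun ω => ∑ i ∈ s, F i ω) P :=
  fun m => memLp_finsetSum s fun i hi => hF i hi m

lemma polynomial_eval [IsFiniteMeasure P] (hf : HasAllMoments f P) (p : Polynomial ℝ) :
    HasAllMoments (fun ω => p.eval (f ω)) P := by
  simp_rw [Polynomial.eval_eq_sum, Polynomial.sum]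
  exact finset_sum _ fun i _ => (hf.pow i).const_mul _

end HasAllMoments

/-! ### Products of Hermite polynomials of jointly Gaussian variables -/

/-- A centered Gaussian family with unit variances and covariance function `ρ`. -/
structure IsStandardGaussianFamily {Ω T : Type*} [MeasurableSpace Ω] (X : T → Ω → ℝ)
    (ρ : T → T → ℝ) (P : Measure Ω) : Prop where
  gaussian : IsGaussianProcess X P
  centered : ∀ t, ∫ ω, X t ω ∂P = 0
  covariance : ∀ s t, ∫ ω, X s ω * X t ω ∂P = ρ s t
  diag : ∀ t, ρ t t = 1

namespace IsStandardGaussianFamily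

variable {Ω T : Type*} [MeasurableSpace Ω] {X : T → Ω → ℝ} {ρ : T → T → ℝ} {P : Measure Ω}

lemma hasAllMoments (h : IsStandardGaussianFamily X ρ P) (t : T) : HasAllMoments (X t) P :=
  fun _ => (h.gaussian.hasGaussianLaw_eval t).memLp (by simp)

lemma symm (h : IsStandardGaussianFamily X ρ P) (s t : T) : ρ s t = ρ t s := by
  rw [← h.covariance, ← h.covariance]
  simp_rw [mul_comm]

lemma law (h : IsStandardGaussianFamily X ρ P) (t : T) : P.map (X t) = gaussianReal 0 1 := by
  rw [(h.gaussian.hasGaussianLaw_eval t).map_eq_gaussianReal, h.centered t,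
    variance_eq_integral (h.gaussian.aemeasurable t), h.centered t]
  simp only [sub_zero, pow_two]
  rw [h.covariance, h.diag]
  simp

variable [IsProbabilityMeasure P]

lemma hermite_hasAllMoments (h : IsStandardGaussianFamily X ρ P) (a : ℕ) (t : T) :
    HasAllMoments (fun ω => (realHermite a).eval (X t ω)) P :=
  (h.hasAllMoments t).polynomial_eval _

/-- The residuals of the regression on `X s` are independent of `X s`. -/
lemma indepFun_residual (h : IsStandardGaussianFamily X ρ P) (s : T) {n : ℕ} (t : Fin n → T) :
    IndepFun (X s) (fun ω (j : Fin n) => X (t j) ω - ρ s (t j) * X s ω) P := by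
  classical
  have hG : IsGaussianProcess (Sum.elim (fun _ : Unit => X s)
      (fun (j : Fin n) ω => X (t j) ω - ρ s (t j) * X s ω)) P := by
    have hX := h.gaussian
    refine hX.of_isGaussianProcess fun i => ?_
    rcases i with _ | j
    · exact ⟨{s},
        { toFun x := x ⟨s, by simp⟩
          map_add' := by simp
          map_smul' := by simp }, by simp⟩
    · exact ⟨{s, t j},
        { toFun x := x ⟨t j, by simp⟩ - ρ s (t j) * x ⟨s, by simp⟩
          map_add' x y := by simp; ring
          map_smul' c x := by simp; ring }, by simp⟩
  have hm (j : Fin n) : HasAllMoments (fun ω => X (t j) ω - ρ s (t j) * X s ω) P := by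
    simpa [sub_eq_add_neg] using
      (h.hasAllMoments (t j)).add ((h.hasAllMoments s).const_mul (-ρ s (t j)))
  -- Jointly Gaussian and uncorrelated implies independent; the covariance is `ρ s t - ρ s t * ρ s
  -- s`, which is zero by the unit variance.
  have := hG.indepFun_of_covariance_eq_zero (fun _ => h.gaussian.aemeasurable s)
    (fun j => (hm j).integrable.aemeasurable) (fun _ j => by
      rw [covariance_eq_sub (h.hasAllMoments s).memLp_two (hm j).memLp_two, h.centered, zero_mul,
        sub_zero]
      have : X s * (fun ω => X (t j) ω - ρ s (t j) * X s ω) =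
          fun ω => X s ω * X (t j) ω - ρ s (t j) * (X s ω * X s ω) := by
        ext ω; simp; ring
      rw [this, integral_sub, integral_const_mul, h.covariance, h.covariance, h.diag]
      · ring
      · exact ((h.hasAllMoments s).mul (h.hasAllMoments _)).integrable
      · exact (((h.hasAllMoments s).mul (h.hasAllMoments _)).const_mul _).integrable)
  exact this.comp (φ := fun f : Unit → ℝ => f ()) (measurable_pi_apply _) measurable_id

open Polynomial in
/-- Repeated integration by parts in the first of four Hermite factors. -/
lemma integral_four_eq_sum (h : IsStandardGaussianFamily X ρ P) (a b c d : ℕ) (s t u v : T) :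
    ∫ ω, (realHermite a).eval (X s ω) * ((realHermite b).eval (X t ω) *
      ((realHermite c).eval (X u ω) * (realHermite d).eval (X v ω))) ∂P =
    ∑ k ∈ Finset.range (a + 1), ∑ l ∈ Finset.range (k + 1),
      (a.choose k * k.choose l * b.descFactorial (a - k) * c.descFactorial (k - l) *
        d.descFactorial l : ℝ) * (ρ s t ^ (a - k) * ρ s u ^ (k - l) * ρ s v ^ l) *
      ∫ ω, (realHermite (b - (a - k))).eval (X t ω) *
        ((realHermite (c - (k - l))).eval (X u ω) * (realHermite (d - l)).eval (X v ω)) ∂P := by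
  -- With the residuals `Y` frozen, the other three Hermite factors are polynomials in `X s` alone,
  -- and `K` is their product.
  let Y : Ω → Fin 3 → ℝ := fun ω j => X (![t, u, v] j) ω - ρ s (![t, u, v] j) * X s ω
  let A (b : ℕ) (t : T) (j : Fin 3) (y : Fin 3 → ℝ) : ℝ[X] :=
    (realHermite b).comp (C (ρ s t) * Polynomial.X + C (y j))
  let K : (Fin 3 → ℝ) → ℝ[X] := fun y => A b t 0 y * (A c u 1 y * A d v 2 y)
  have hA (b t j) : Continuous fun z : ℝ × (Fin 3 → ℝ) => (A b t j z.2).eval z.1 := by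
    simp only [A, eval_comp, eval_add, eval_mul, eval_C, eval_X]
    exact (realHermite b).continuous.comp (by fun_prop)
  -- Leibniz twice: `a - k`, `k - l` and `l` derivatives fall on the three factors, each bringing
  -- out a power of the matching covariance.
  have hK' (y : Fin 3 → ℝ) : derivative^[a] (K y) =
      ∑ k ∈ Finset.range (a + 1), ∑ l ∈ Finset.range (k + 1),
        C ((a.choose k * k.choose l * b.descFactorial (a - k) * c.descFactorial (k - l) *
        d.descFactorial l : ℝ) * (ρ s t ^ (a - k) * ρ s u ^ (k - l) * ρ s v ^ l)) *
        (A (b - (a - k)) t 0 y * (A (c - (k - l)) u 1 y * A (d - l) v 2 y)) := by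
    simp only [K, A]
    rw [iterate_derivative_mul]
    refine Finset.sum_congr rfl fun k _ => ?_
    rw [iterate_derivative_mul, Finset.mul_sum, Finset.smul_sum]
    refine Finset.sum_congr rfl fun l _ => ?_
    rw [iterate_derivative_realHermite_comp, iterate_derivative_realHermite_comp,
      iterate_derivative_realHermite_comp]
    simp only [nsmul_eq_mul, map_mul, map_pow, map_natCast]
    ring
  have hAX (b : ℕ) (j : Fin 3) (ω : Ω) : (A b (![t, u, v] j) j (Y ω)).eval (X s ω) =
      (realHermite b).eval (X (![t, u, v] j) ω) := by
    simp [A, Y]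
  have hA0 (b : ℕ) (ω : Ω) : (A b t 0 (Y ω)).eval (X s ω) = (realHermite b).eval (X t ω) :=
    hAX b 0 ω
  have hA1 (b : ℕ) (ω : Ω) : (A b u 1 (Y ω)).eval (X s ω) = (realHermite b).eval (X u ω) :=
    hAX b 1 ω
  have hA2 (b : ℕ) (ω : Ω) : (A b v 2 (Y ω)).eval (X s ω) = (realHermite b).eval (X v ω) :=
    hAX b 2 ω
  have hKX (ω : Ω) : (K (Y ω)).eval (X s ω) = (realHermite b).eval (X t ω) *
      ((realHermite c).eval (X u ω) * (realHermite d).eval (X v ω)) := by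
    simp only [K, eval_mul, hA0, hA1, hA2]
  have hDX (ω : Ω) : (derivative^[a] (K (Y ω))).eval (X s ω) =
      ∑ k ∈ Finset.range (a + 1), ∑ l ∈ Finset.range (k + 1),
      (a.choose k * k.choose l * b.descFactorial (a - k) * c.descFactorial (k - l) *
        d.descFactorial l : ℝ) * (ρ s t ^ (a - k) * ρ s u ^ (k - l) * ρ s v ^ l) *
      ((realHermite (b - (a - k))).eval (X t ω) *
        ((realHermite (c - (k - l))).eval (X u ω) * (realHermite (d - l)).eval (X v ω))) := by
    simp only [hK', eval_finsetSum, eval_mul, hA0, hA1, hA2, eval_C]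
  have hm (b c d : ℕ) : HasAllMoments (fun ω => (realHermite b).eval (X t ω) *
        ((realHermite c).eval (X u ω) * (realHermite d).eval (X v ω))) P :=
    (h.hermite_hasAllMoments b t).mul
      ((h.hermite_hasAllMoments c u).mul (h.hermite_hasAllMoments d v))
  have hm' (k l : ℕ) := (hm (b - (a - k)) (c - (k - l)) (d - l)).const_mul
    ((a.choose k * k.choose l * b.descFactorial (a - k) * c.descFactorial (k - l) *
        d.descFactorial l : ℝ) * (ρ s t ^ (a - k) * ρ s u ^ (k - l) * ρ s v ^ l))
  have key := IndepFun.integral_realHermite_mul (Y := Y) (h.gaussian.aemeasurable s)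
    (aemeasurable_pi_lambda _ fun j =>
      (h.gaussian.aemeasurable _).sub ((h.gaussian.aemeasurable s).const_mul _))
    (h.indepFun_residual s ![t, u, v]) (h.law s) a K
    (by simp only [K, eval_mul]; exact (hA _ _ _).mul ((hA _ _ _).mul (hA _ _ _)))
    (by
      simp only [hK', eval_finsetSum, eval_mul, eval_C]
      exact continuous_finsetSum _ fun k _ => continuous_finsetSum _ fun l _ =>
        continuous_const.mul ((hA _ _ _).mul ((hA _ _ _).mul (hA _ _ _))))
    (by
      simp only [hKX]
      exact ((h.hermite_hasAllMoments a s).mul (hm b c d)).integrable)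
    (by
      simp only [hDX]
      exact (HasAllMoments.finset_sum _ fun k _ => HasAllMoments.finset_sum _ fun l _ =>
        hm' k l).integrable)
  simp only [hKX, hDX] at key
  rw [key, integral_finsetSum _ fun k _ => (HasAllMoments.finset_sum _ fun l _ =>
    hm' k l).integrable]
  refine Finset.sum_congr rfl fun k _ => ?_
  rw [integral_finsetSum _ fun l _ => (hm' k l).integrable]
  exact Finset.sum_congr rfl fun l _ => integral_const_mul _ _

end IsStandardGaussianFamily

namespace IsStandardGaussianFamily

variable {Ω T : Type*} [MeasurableSpace Ω] {X : T → Ω → ℝ} {ρ : T → T → ℝ} {P : Measure Ω}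

lemma integral_hermite (h : IsStandardGaussianFamily X ρ P) {a : ℕ} (ha : a ≠ 0) (t : T) :
    ∫ ω, (realHermite a).eval (X t ω) ∂P = 0 := by
  have h1 := integral_realHermite_mul_eval_gaussianReal a 1
  rw [← h.law t, integral_map (h.gaussian.aemeasurable t)
    (by simpa using (realHermite a).continuous.aestronglyMeasurable)] at h1
  obtain ⟨n, rfl⟩ := Nat.exists_eq_succ_of_ne_zero ha
  simpa [Function.iterate_succ_apply, Polynomial.iterate_derivative_zero] using h1

variable [IsProbabilityMeasure P]

lemma integral_hermite_two (h : IsStandardGaussianFamily X ρ P) (a b : ℕ) (s t : T) :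
    ∫ ω, (realHermite a).eval (X s ω) * (realHermite b).eval (X t ω) ∂P =
      if a = b then (a.factorial : ℝ) * ρ s t ^ a else 0 := by
  have h4 := h.integral_four_eq_sum a b 0 0 s t t t
  rw [Finset.sum_eq_single_of_mem 0 (by simp)] at h4
  · simp only [realHermite_zero, Polynomial.eval_one, mul_one, zero_add, Finset.range_one,
      Finset.sum_singleton, Nat.choose_zero_right, Nat.sub_zero, Nat.cast_one, one_mul,
      Nat.descFactorial_zero, pow_zero] at h4
    rw [h4]
    rcases lt_trichotomy a b with hab | rfl | hab
    · rw [h.integral_hermite (by omega)]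
      simp [hab.ne]
    · simp [Nat.descFactorial_self]
    · simp [Nat.descFactorial_of_lt hab, hab.ne']
  · intro k _ hk
    refine Finset.sum_eq_zero fun l hl => ?_
    rcases Nat.eq_zero_or_pos l with rfl | hl'
    · rw [Nat.descFactorial_of_lt (show 0 < k - 0 by omega)]; simp
    · rw [Nat.descFactorial_of_lt hl']; simp

lemma integral_hermite_three_eq_sum (h : IsStandardGaussianFamily X ρ P) (a b c : ℕ) (s t u : T) :
    ∫ ω, (realHermite a).eval (X s ω) * ((realHermite b).eval (X t ω) *
      (realHermite c).eval (X u ω)) ∂P =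
    ∑ k ∈ Finset.range (a + 1),
      (a.choose k * b.descFactorial (a - k) * c.descFactorial k : ℝ) *
        (ρ s t ^ (a - k) * ρ s u ^ k) *
      if b - (a - k) = c - k then ((b - (a - k)).factorial : ℝ) * ρ t u ^ (b - (a - k)) else 0 := by
  have h4 := h.integral_four_eq_sum a b c 0 s t u u
  simp only [realHermite_zero, Polynomial.eval_one, mul_one, Nat.zero_sub] at h4
  rw [h4]
  refine Finset.sum_congr rfl fun k _ => ?_
  rw [Finset.sum_eq_single_of_mem 0 (by simp)]
  · simp [h.integral_hermite_two]
  · intro l _ hl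
    rw [Nat.descFactorial_of_lt (show 0 < l by omega)]; simp

/-- The exponents are the numbers of contractions along the three edges of a triangle. The three
degrees determine them, so one term of the sum survives. -/
lemma integral_hermite_three (h : IsStandardGaussianFamily X ρ P) (α β γ : ℕ) (s t u : T) :
    ∫ ω, (realHermite (β + γ)).eval (X s ω) * ((realHermite (α + γ)).eval (X t ω) *
      (realHermite (α + β)).eval (X u ω)) ∂P =
    ((β + γ).factorial * (α + γ).factorial * (α + β).factorial /
      (α.factorial * β.factorial * γ.factorial) : ℝ) *
      (ρ t u ^ α * ρ s u ^ β * ρ s t ^ γ) := by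
  rw [h.integral_hermite_three_eq_sum, Finset.sum_eq_single_of_mem β (by simp)]
  · have e1 : β + γ - β = γ := by omega
    have e2 : α + γ - γ = α := by omega
    have e3 : α + β - β = α := by omega
    rw [e1, e2, e3, if_pos rfl, Nat.cast_add_choose ℝ]
    have d1 : ((α + γ).descFactorial γ : ℝ) = (α + γ).factorial / α.factorial := by
      rw [Nat.descFactorial_eq_div (by omega), e2,
        Nat.cast_div (Nat.factorial_dvd_factorial (by omega)) (by positivity)]
    have d2 : ((α + β).descFactorial β : ℝ) = (α + β).factorial / α.factorial := by
      rw [Nat.descFactorial_eq_div (by omega), e3,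
        Nat.cast_div (Nat.factorial_dvd_factorial (by omega)) (by positivity)]
    rw [d1, d2]
    field_simp
  · intro k hk hkβ
    rw [Finset.mem_range] at hk
    by_cases h1 : β + γ - k ≤ α + γ
    · by_cases h2 : k ≤ α + β
      · rw [if_neg (by omega)]; simp
      · rw [Nat.descFactorial_of_lt (show α + β < k by omega)]; simp
    · rw [Nat.descFactorial_of_lt (show α + γ < β + γ - k by omega)]; simp

/-- After `k` contractions from `s` to `u` and `q - k` to `t`, the leftover degrees at `t` and `u`
are `k` and `q - k`, which differ when `q` is odd. -/
lemma integral_hermite_three_of_odd (h : IsStandardGaussianFamily X ρ P) {q : ℕ} (hq : Odd q)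
    (s t u : T) :
    ∫ ω, (realHermite q).eval (X s ω) * ((realHermite q).eval (X t ω) *
      (realHermite q).eval (X u ω)) ∂P = 0 := by
  rw [h.integral_hermite_three_eq_sum]
  refine Finset.sum_eq_zero fun k hk => ?_
  rw [Finset.mem_range] at hk
  obtain ⟨m, rfl⟩ := hq
  rw [if_neg (by omega)]; simp

/-- Contracting the vertex `s` with multiplicities `α + β + γ = q` leaves degrees `β + γ`, `α + γ`,
`α + β`, the exact shape of `integral_hermite_three`. Opposite edges therefore carry equal
multiplicity, and the moment depends only on the three pairing products. -/
lemma integral_hermite_four (h : IsStandardGaussianFamily X ρ P) (q : ℕ) (s t u v : T) :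
    ∫ ω, (realHermite q).eval (X s ω) * ((realHermite q).eval (X t ω) *
      ((realHermite q).eval (X u ω) * (realHermite q).eval (X v ω))) ∂P =
    ∑ k ∈ Finset.range (q + 1), ∑ l ∈ Finset.range (k + 1),
      ((q.factorial : ℝ) ^ 2 / ((q - k).factorial * (k - l).factorial * l.factorial)) ^ 2 *
        ((ρ s t * ρ u v) ^ (q - k) * (ρ s u * ρ t v) ^ (k - l) * (ρ s v * ρ t u) ^ l) := by
  rw [h.integral_four_eq_sum]
  refine Finset.sum_congr rfl fun k hk => Finset.sum_congr rfl fun l hl => ?_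
  rw [Finset.mem_range] at hk hl
  obtain ⟨γ, rfl⟩ : ∃ γ, γ = l := ⟨l, rfl⟩
  obtain ⟨β, rfl⟩ : ∃ β, k = β + γ := ⟨k - γ, by omega⟩
  obtain ⟨α, rfl⟩ : ∃ α, q = α + (β + γ) := ⟨q - (β + γ), by omega⟩
  have e1 : α + (β + γ) - (β + γ) = α := by omega
  have e2 : β + γ - γ = β := by omega
  have e3 : α + (β + γ) - α = β + γ := by omega
  have e4 : α + (β + γ) - β = α + γ := by omega
  have e5 : α + (β + γ) - γ = α + β := by omega
  rw [e1, e2, e3, e4, e5, h.integral_hermite_three]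
  have c1 : ((α + (β + γ)).choose (β + γ) : ℝ) =
      (α + (β + γ)).factorial / (α.factorial * (β + γ).factorial) := by
    rw [← Nat.choose_symm_add, Nat.cast_add_choose ℝ]
  have c2 : ((β + γ).choose γ : ℝ) = (β + γ).factorial / (β.factorial * γ.factorial) := by
    rw [← Nat.choose_symm_add, Nat.cast_add_choose ℝ]
  have d1 : ((α + (β + γ)).descFactorial α : ℝ) = (α + (β + γ)).factorial / (β + γ).factorial := by
    rw [Nat.descFactorial_eq_div (by omega), e3,
      Nat.cast_div (Nat.factorial_dvd_factorial (by omega)) (by positivity)]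
  have d2 : ((α + (β + γ)).descFactorial β : ℝ) = (α + (β + γ)).factorial / (α + γ).factorial := by
    rw [Nat.descFactorial_eq_div (by omega), e4,
      Nat.cast_div (Nat.factorial_dvd_factorial (by omega)) (by positivity)]
  have d3 : ((α + (β + γ)).descFactorial γ : ℝ) = (α + (β + γ)).factorial / (α + β).factorial := by
    rw [Nat.descFactorial_eq_div (by omega), e5,
      Nat.cast_div (Nat.factorial_dvd_factorial (by omega)) (by positivity)]
  rw [c1, c2, d1, d2, d3]
  simp only [mul_pow]
  field_simp

end IsStandardGaussianFamily

/-! ### Third and fourth cumulants in terms of moments -/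

/-- The derivatives of the logarithm of a characteristic function of a centered variable. -/
lemma iteratedDeriv_log_zero {φ : ℝ → ℂ} (hφ : ContDiff ℝ 4 φ) (h0 : φ 0 = 1)
    (h1 : iteratedDeriv 1 φ 0 = 0) :
    iteratedDeriv 3 (fun t => Complex.log (φ t)) 0 = iteratedDeriv 3 φ 0 ∧
    iteratedDeriv 4 (fun t => Complex.log (φ t)) 0 =
      iteratedDeriv 4 φ 0 - 3 * iteratedDeriv 2 φ 0 ^ 2 := by
  set L : ℝ → ℂ := fun t => Complex.log (φ t)
  have hslit : ∀ᶠ t in 𝓝 (0 : ℝ), φ t ∈ Complex.slitPlane :=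
    hφ.continuous.continuousAt.eventually_mem
      (Complex.isOpen_slitPlane.mem_nhds (by rw [h0]; exact Complex.one_mem_slitPlane))
  have hd : Differentiable ℝ φ := hφ.differentiable (by norm_num)
  have hdL : ∀ᶠ t in 𝓝 (0 : ℝ), deriv L t = deriv φ t * (φ t)⁻¹ := by
    filter_upwards [hslit] with t ht
    rw [← div_eq_mul_inv]
    exact ((hd t).hasDerivAt.clog_real ht).deriv
  have hprod : (fun t => (deriv φ t * (φ t)⁻¹) * φ t) =ᶠ[𝓝 0] deriv φ := by
    filter_upwards [hslit] with t ht
    rw [mul_assoc, inv_mul_cancel₀ (Complex.slitPlane_ne_zero ht), mul_one]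
  have hφ' : ContDiff ℝ 3 (deriv φ) := by
    have : ContDiff ℝ (3 + 1) φ := by norm_num; exact hφ
    exact (contDiff_succ_iff_deriv.1 this).2.2
  have hG : ContDiffAt ℝ 3 (fun t => deriv φ t * (φ t)⁻¹) 0 :=
    hφ'.contDiffAt.mul ((hφ.contDiffAt.of_le (by norm_num)).inv (by rw [h0]; exact one_ne_zero))
  set G : ℝ → ℂ := fun t => deriv φ t * (φ t)⁻¹
  have hL (k : ℕ) : iteratedDeriv (k + 1) L 0 = iteratedDeriv k G 0 := by
    rw [iteratedDeriv_succ']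
    exact Filter.EventuallyEq.iteratedDeriv_eq k hdL
  -- Applying Leibniz to `G * φ = φ'` avoids differentiating a quotient: the resulting triangular
  -- system is solved for the derivatives of `G`.
  have hleib (k : ℕ) (hk : k ≤ 3) : iteratedDeriv (k + 1) φ 0 =
      ∑ i ∈ Finset.range (k + 1),
        (k.choose i : ℂ) * iteratedDeriv i G 0 * iteratedDeriv (k - i) φ 0 := by
    rw [iteratedDeriv_succ', ← hprod.iteratedDeriv_eq k]
    have hk' : (k : WithTop ℕ∞) ≤ 3 := by exact_mod_cast hk
    exact iteratedDeriv_fun_mul (hG.of_le hk')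
      (hφ.contDiffAt.of_le (hk'.trans (by norm_num)))
  have e0 := hleib 0 (by norm_num)
  have e1 := hleib 1 (by norm_num)
  have e2 := hleib 2 (by norm_num)
  have e3 := hleib 3 (by norm_num)
  simp only [Finset.sum_range_succ, Finset.sum_range_zero, Nat.choose_self, Nat.choose_zero_right,
    Nat.choose_one_right, Nat.cast_one, one_mul,
    zero_add, Nat.sub_zero, Nat.sub_self, Nat.reduceSub, Nat.reduceAdd, iteratedDeriv_zero,
    h0, h1, mul_one, mul_zero, add_zero, show Nat.choose 3 2 = 3 from rfl] at e0 e1 e2 e3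
  rw [hL 2, hL 3]
  rw [← e0] at e2 e3
  simp only [zero_mul, zero_add] at e1 e2 e3
  rw [← e1] at e3
  push_cast at e3
  exact ⟨e2.symm, by linear_combination -e3⟩

section Cumulant

variable {Ω : Type*} [MeasurableSpace Ω] {P : Measure Ω} [IsProbabilityMeasure P] {F : Ω → ℝ}

lemma HasAllMoments.memLp_id_map (hF : HasAllMoments F P) (m : ℕ) : MemLp id m (P.map F) := by
  rw [memLp_map_measure_iff (by fun_prop) hF.integrable.aemeasurable]
  exact hF m

lemma HasAllMoments.iteratedDeriv_charFun_map_zero (hF : HasAllMoments F P) (m : ℕ) :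
    iteratedDeriv m (charFun (P.map F)) 0 = Complex.I ^ m * ((∫ ω, F ω ^ m ∂P : ℝ) : ℂ) := by
  have : IsProbabilityMeasure (P.map F) :=
    Measure.isProbabilityMeasure_map hF.integrable.aemeasurable
  rw [iteratedDeriv_charFun_zero (hF.memLp_id_map m),
    integral_map hF.integrable.aemeasurable (by fun_prop)]

lemma HasAllMoments.cumulant_three_four (hF : HasAllMoments F P) (h0 : ∫ ω, F ω ∂P = 0) :
    cumulant P 3 F = ∫ ω, F ω ^ 3 ∂P ∧
      cumulant P 4 F = ∫ ω, F ω ^ 4 ∂P - 3 * (∫ ω, F ω ^ 2 ∂P) ^ 2 := by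
  have : IsProbabilityMeasure (P.map F) :=
    Measure.isProbabilityMeasure_map hF.integrable.aemeasurable
  obtain ⟨h3, h4⟩ := iteratedDeriv_log_zero (φ := charFun (P.map F))
    (by exact_mod_cast contDiff_charFun (hF.memLp_id_map 4)) (by simp)
    (by rw [hF.iteratedDeriv_charFun_map_zero]; simp [h0])
  have i3 : (-Complex.I) ^ 3 * Complex.I ^ 3 = 1 := by
    rw [← mul_pow]; simp
  have i4 : (-Complex.I) ^ 4 = 1 := by
    rw [neg_pow, Complex.I_pow_four]; norm_num
  constructor
  · rw [cumulant, h3, hF.iteratedDeriv_charFun_map_zero, ← mul_assoc, i3, one_mul,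
      Complex.ofReal_re]
  · rw [cumulant, h4, hF.iteratedDeriv_charFun_map_zero, hF.iteratedDeriv_charFun_map_zero, i4,
      Complex.I_pow_four, Complex.I_sq]
    simp only [one_mul, neg_mul]
    norm_cast
    ring

end Cumulant

/-! ### Sums over quadruples -/

section QuadrupleSum

variable {T : Type*}

/-- The sum over quadruples of a function of the three pairings of the indices. -/
def pairingSum (s : Finset T) (ρ : T → T → ℝ) (Φ : ℝ → ℝ → ℝ → ℝ) : ℝ :=
  ∑ i ∈ s, ∑ j ∈ s, ∑ k ∈ s, ∑ l ∈ s, Φ (ρ i j * ρ k l) (ρ i k * ρ j l) (ρ i l * ρ j k)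

variable {s : Finset T} {ρ : T → T → ℝ}

/-- Relabelling `j ↔ k` exchanges the first two pairings. With `pairingSum_swap_right` this gives
all permutations, so the six extremal mixed monomials have equal sums. -/
lemma pairingSum_swap_left (hρ : ∀ i j, ρ i j = ρ j i) (Φ : ℝ → ℝ → ℝ → ℝ) :
    pairingSum s ρ (fun x y z => Φ y x z) = pairingSum s ρ Φ := by
  unfold pairingSum
  refine Finset.sum_congr rfl fun i _ => ?_
  rw [Finset.sum_comm]
  refine Finset.sum_congr rfl fun j _ => Finset.sum_congr rfl fun k _ =>
    Finset.sum_congr rfl fun l _ => ?_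
  rw [hρ j k]

lemma pairingSum_swap_right (hρ : ∀ i j, ρ i j = ρ j i) (Φ : ℝ → ℝ → ℝ → ℝ) :
    pairingSum s ρ (fun x y z => Φ x z y) = pairingSum s ρ Φ := by
  unfold pairingSum
  refine Finset.sum_congr rfl fun i _ => Finset.sum_congr rfl fun j _ => ?_
  rw [Finset.sum_comm]
  refine Finset.sum_congr rfl fun k _ => Finset.sum_congr rfl fun l _ => ?_
  rw [hρ k l]

lemma pairingSum_add (Φ Ψ : ℝ → ℝ → ℝ → ℝ) :
    pairingSum s ρ (fun x y z => Φ x y z + Ψ x y z) = pairingSum s ρ Φ + pairingSum s ρ Ψ := by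
  simp only [pairingSum, Finset.sum_add_distrib]

lemma pairingSum_const_mul (c : ℝ) (Φ : ℝ → ℝ → ℝ → ℝ) :
    pairingSum s ρ (fun x y z => c * Φ x y z) = c * pairingSum s ρ Φ := by
  simp only [pairingSum, Finset.mul_sum]

lemma pairingSum_mono (h0 : ∀ i j, 0 ≤ ρ i j) (h1 : ∀ i j, ρ i j ≤ 1) {Φ Ψ : ℝ → ℝ → ℝ → ℝ}
    (h : ∀ x y z, x ∈ Set.Icc (0 : ℝ) 1 → y ∈ Set.Icc (0 : ℝ) 1 → z ∈ Set.Icc (0 : ℝ) 1 →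
      Φ x y z ≤ Ψ x y z) :
    pairingSum s ρ Φ ≤ pairingSum s ρ Ψ := by
  have hm (i j k l : T) : ρ i j * ρ k l ∈ Set.Icc (0 : ℝ) 1 :=
    ⟨mul_nonneg (h0 _ _) (h0 _ _), mul_le_one₀ (h1 _ _) (h0 _ _) (h1 _ _)⟩
  exact Finset.sum_le_sum fun i _ => Finset.sum_le_sum fun j _ => Finset.sum_le_sum fun k _ =>
    Finset.sum_le_sum fun l _ => h _ _ _ (hm _ _ _ _) (hm _ _ _ _) (hm _ _ _ _)

lemma pairingSum_left_pow (q : ℕ) :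
    pairingSum s ρ (fun x _ _ => x ^ q) = (∑ i ∈ s, ∑ j ∈ s, ρ i j ^ q) ^ 2 := by
  simp only [pairingSum, pow_two (∑ i ∈ s, _), Finset.sum_mul]
  simp only [Finset.mul_sum, mul_pow]

/-- All terms are nonnegative; only those with `j = i` and `l = k` are kept. -/
lemma sum_sq_le_pairingSum (h0 : ∀ i j, 0 ≤ ρ i j) (hd : ∀ i, ρ i i = 1) (m : ℕ) :
    ∑ i ∈ s, ∑ k ∈ s, ρ i k ^ 2 ≤ pairingSum s ρ (fun x y _ => x ^ m * y) := by
  have hn (i j k l : T) : 0 ≤ (ρ i j * ρ k l) ^ m * (ρ i k * ρ j l) :=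
    mul_nonneg (pow_nonneg (mul_nonneg (h0 _ _) (h0 _ _)) _) (mul_nonneg (h0 _ _) (h0 _ _))
  refine Finset.sum_le_sum fun i hi => ?_
  refine le_trans (Finset.sum_le_sum fun k hk => ?_) (Finset.single_le_sum
    (f := fun j => ∑ k ∈ s, ∑ l ∈ s, (ρ i j * ρ k l) ^ m * (ρ i k * ρ j l))
    (fun j _ => Finset.sum_nonneg fun k _ => Finset.sum_nonneg fun l _ => hn i j k l) hi)
  refine le_trans (le_of_eq ?_) (Finset.single_le_sum
    (f := fun l => (ρ i i * ρ k l) ^ m * (ρ i k * ρ i l)) (fun l _ => hn i i k l) hk)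
  simp [hd, pow_two]

/-- The edges `ij`, `jl`, `lk`, `ki` form a cycle. The inequality `ρ i k * ρ j l ≤ (ρ i k ^ 2 + ρ j
l ^ 2) / 2` cuts it into paths, whose two outer edges are then summed separately, each costing a
factor `G`. -/
lemma pairingSum_le (hρ : ∀ i j, ρ i j = ρ j i) (h0 : ∀ i j, 0 ≤ ρ i j) {m : ℕ} {G : ℝ}
    (hG : ∀ i, ∑ j ∈ s, ρ i j ^ m ≤ G) :
    pairingSum s ρ (fun x y _ => x ^ m * y) ≤ G ^ 2 * ∑ i ∈ s, ∑ k ∈ s, ρ i k ^ 2 := by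
  have hb : ∑ i ∈ s, ∑ j ∈ s, ∑ k ∈ s, ∑ l ∈ s, ρ i j ^ m * ρ k l ^ m * ρ i k ^ 2 ≤
      G ^ 2 * ∑ i ∈ s, ∑ k ∈ s, ρ i k ^ 2 := by
    rw [Finset.mul_sum]
    refine Finset.sum_le_sum fun i _ => ?_
    rw [Finset.sum_comm, Finset.mul_sum]
    refine Finset.sum_le_sum fun k _ => ?_
    have : ∑ j ∈ s, ∑ l ∈ s, ρ i j ^ m * ρ k l ^ m * ρ i k ^ 2 =
        ((∑ j ∈ s, ρ i j ^ m) * ∑ l ∈ s, ρ k l ^ m) * ρ i k ^ 2 := by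
      rw [Finset.sum_mul_sum, Finset.sum_mul]
      simp_rw [Finset.sum_mul]
    rw [this, pow_two G]
    have hnn (i : T) : 0 ≤ ∑ j ∈ s, ρ i j ^ m := Finset.sum_nonneg fun j _ => pow_nonneg (h0 _ _) _
    exact mul_le_mul_of_nonneg_right
      (mul_le_mul (hG i) (hG k) (hnn k) ((hnn i).trans (hG i))) (sq_nonneg _)
  have hb' : ∑ i ∈ s, ∑ j ∈ s, ∑ k ∈ s, ∑ l ∈ s, ρ i j ^ m * ρ k l ^ m * ρ j l ^ 2 ≤
      G ^ 2 * ∑ i ∈ s, ∑ k ∈ s, ρ i k ^ 2 := by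
    refine le_trans (le_of_eq ?_) hb
    rw [Finset.sum_comm]
    refine Finset.sum_congr rfl fun i _ => Finset.sum_congr rfl fun j _ => ?_
    rw [Finset.sum_comm]
    refine Finset.sum_congr rfl fun k _ => Finset.sum_congr rfl fun l _ => ?_
    rw [hρ j i, hρ l k]
  have hab : pairingSum s ρ (fun x y _ => x ^ m * y) ≤
      ∑ i ∈ s, ∑ j ∈ s, ∑ k ∈ s, ∑ l ∈ s, (ρ i j ^ m * ρ k l ^ m * ρ i k ^ 2 / 2 +
        ρ i j ^ m * ρ k l ^ m * ρ j l ^ 2 / 2) := by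
    refine Finset.sum_le_sum fun i _ => Finset.sum_le_sum fun j _ => Finset.sum_le_sum fun k _ =>
      Finset.sum_le_sum fun l _ => ?_
    have h2 : ρ i k * ρ j l ≤ ρ i k ^ 2 / 2 + ρ j l ^ 2 / 2 := by
      nlinarith [sq_nonneg (ρ i k - ρ j l)]
    have h3 : 0 ≤ ρ i j ^ m * ρ k l ^ m := mul_nonneg (pow_nonneg (h0 _ _) _) (pow_nonneg (h0 _ _) _)
    calc (ρ i j * ρ k l) ^ m * (ρ i k * ρ j l)
        ≤ ρ i j ^ m * ρ k l ^ m * (ρ i k ^ 2 / 2 + ρ j l ^ 2 / 2) := by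
          rw [mul_pow]; exact mul_le_mul_of_nonneg_left h2 h3
      _ = _ := by ring
  refine hab.trans ?_
  simp only [Finset.sum_add_distrib, ← Finset.sum_div]
  linarith

end QuadrupleSum

/-! ### The polynomial of the four-point function -/

/-- The four-point function of the `q`-th Hermite polynomial in terms of the three pairings. -/
noncomputable def fourPoint (q : ℕ) (x y z : ℝ) : ℝ :=
  ∑ k ∈ Finset.range (q + 1), ∑ l ∈ Finset.range (k + 1),
    ((q.factorial : ℝ) ^ 2 / ((q - k).factorial * (k - l).factorial * l.factorial)) ^ 2 *
      (x ^ (q - k) * y ^ (k - l) * z ^ l)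

/-- The index set of the monomials of `fourPoint q`. -/
def fourPointIndex (q : ℕ) : Finset (Σ _ : ℕ, ℕ) :=
  (Finset.range (q + 1)).sigma fun k => Finset.range (k + 1)

/-- The coefficients of `fourPoint q`. -/
noncomputable def fourPointCoeff (q : ℕ) (p : Σ _ : ℕ, ℕ) : ℝ :=
  ((q.factorial : ℝ) ^ 2 / ((q - p.1).factorial * (p.1 - p.2).factorial * p.2.factorial)) ^ 2

lemma fourPointCoeff_nonneg (q : ℕ) (p : Σ _ : ℕ, ℕ) : 0 ≤ fourPointCoeff q p := sq_nonneg _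

lemma fourPoint_eq_sum (q : ℕ) (x y z : ℝ) :
    fourPoint q x y z = ∑ p ∈ fourPointIndex q,
      fourPointCoeff q p * (x ^ (q - p.1) * y ^ (p.1 - p.2) * z ^ p.2) := by
  rw [fourPoint, fourPointIndex, Finset.sum_sigma]
  rfl

/-- The pure powers split off from the four-point function. -/
lemma fourPoint_eq_add {q : ℕ} (hq : 0 < q) (x y z : ℝ) :
    fourPoint q x y z = (q.factorial : ℝ) ^ 2 * (x ^ q + y ^ q + z ^ q) +
      ∑ p ∈ fourPointIndex q \ {⟨0, 0⟩, ⟨q, 0⟩, ⟨q, q⟩},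
        fourPointCoeff q p * (x ^ (q - p.1) * y ^ (p.1 - p.2) * z ^ p.2) := by
  have hsub : ({⟨0, 0⟩, ⟨q, 0⟩, ⟨q, q⟩} : Finset (Σ _ : ℕ, ℕ)) ⊆ fourPointIndex q := by
    intro p hp
    simp only [Finset.mem_insert, Finset.mem_singleton] at hp
    rcases hp with rfl | rfl | rfl <;> simp [fourPointIndex]
  have hf : (q.factorial : ℝ) ≠ 0 := by positivity
  rw [fourPoint_eq_sum, ← Finset.sum_sdiff hsub, add_comm]
  congr 1
  rw [Finset.sum_insert, Finset.sum_insert, Finset.sum_singleton]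
  · simp only [fourPointCoeff, Nat.sub_zero, Nat.sub_self, Nat.factorial_zero, Nat.cast_one,
      pow_zero, mul_one, one_mul]
    field_simp
    ring
  · simp [hq.ne]
  · simp [hq.ne]

/-- A single mixed monomial, the one at index `(1, 0)`, is kept; its coefficient is at least one. -/
lemma le_fourPoint {q : ℕ} (hq : 2 ≤ q) {x y z : ℝ} (hx : 0 ≤ x) (hy : 0 ≤ y) (hz : 0 ≤ z) :
    (q.factorial : ℝ) ^ 2 * (x ^ q + y ^ q + z ^ q) + x ^ (q - 1) * y ≤ fourPoint q x y z := by
  rw [fourPoint_eq_add (by omega)]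
  have hmem : (⟨1, 0⟩ : Σ _ : ℕ, ℕ) ∈ fourPointIndex q \ {⟨0, 0⟩, ⟨q, 0⟩, ⟨q, q⟩} := by
    simp [fourPointIndex]; omega
  have h1 := Finset.single_le_sum (f := fun p : Σ _ : ℕ, ℕ =>
    fourPointCoeff q p * (x ^ (q - p.1) * y ^ (p.1 - p.2) * z ^ p.2))
    (fun p _ => mul_nonneg (fourPointCoeff_nonneg q p) (by positivity)) hmem
  have hc : 1 ≤ fourPointCoeff q ⟨1, 0⟩ := by
    have h2 : ((q - 1).factorial : ℝ) ≤ q.factorial := by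
      exact_mod_cast Nat.factorial_le (Nat.sub_le _ _)
    have h3 : (1 : ℝ) ≤ q.factorial := by exact_mod_cast Nat.factorial_pos q
    have h4 : (0 : ℝ) < (q - 1).factorial := by positivity
    simp only [fourPointCoeff, Nat.sub_zero, Nat.factorial_one, Nat.factorial_zero, Nat.cast_one,
      mul_one]
    refine one_le_pow₀ ((one_le_div h4).2 ?_)
    nlinarith
  have h5 : 0 ≤ x ^ (q - 1) * y := by positivity
  simp only [Nat.sub_zero, pow_one, pow_zero, mul_one] at h1
  nlinarith

/-- Since `α < q`, some factor is not the largest variable `x`. One such factor is bounded by `y`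
and all others by `x`. -/
lemma pow_mul_pow_mul_pow_le_of_le {q α β γ : ℕ} (h : α + β + γ = q) (hα : α < q) {x y z : ℝ}
    (hz : 0 ≤ z) (hzy : z ≤ y) (hyx : y ≤ x) : x ^ α * y ^ β * z ^ γ ≤ x ^ (q - 1) * y := by
  have hy : 0 ≤ y := hz.trans hzy
  have hx : 0 ≤ x := hy.trans hyx
  obtain ⟨m, hm⟩ : ∃ m, β + γ = m + 1 := ⟨β + γ - 1, by omega⟩
  calc x ^ α * y ^ β * z ^ γ ≤ x ^ α * y ^ β * y ^ γ := by gcongr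
    _ = x ^ α * (y ^ m * y) := by rw [mul_assoc, ← pow_add, hm, pow_succ]
    _ ≤ x ^ α * (x ^ m * y) := by gcongr
    _ = x ^ (q - 1) * y := by rw [← mul_assoc, ← pow_add]; congr 2; omega

/-- A mixed monomial is dominated by the six extremal ones. -/
lemma pow_mul_pow_mul_pow_le {q α β γ : ℕ} (h : α + β + γ = q) (hα : α < q) (hβ : β < q)
    (hγ : γ < q) {x y z : ℝ} (hx : 0 ≤ x) (hy : 0 ≤ y) (hz : 0 ≤ z) :
    x ^ α * y ^ β * z ^ γ ≤ x ^ (q - 1) * y + y ^ (q - 1) * x + x ^ (q - 1) * z +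
      z ^ (q - 1) * x + y ^ (q - 1) * z + z ^ (q - 1) * y := by
  have p1 : 0 ≤ x ^ (q - 1) * y := by positivity
  have p2 : 0 ≤ y ^ (q - 1) * x := by positivity
  have p3 : 0 ≤ x ^ (q - 1) * z := by positivity
  have p4 : 0 ≤ z ^ (q - 1) * x := by positivity
  have p5 : 0 ≤ y ^ (q - 1) * z := by positivity
  have p6 : 0 ≤ z ^ (q - 1) * y := by positivity
  rcases le_total x y with hxy | hxy <;> rcases le_total y z with hyz | hyz <;>
    rcases le_total x z with hxz | hxz
  · have := pow_mul_pow_mul_pow_le_of_le (show γ + β + α = q by omega) hγ hx hxy hyz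
    linarith [show z ^ γ * y ^ β * x ^ α = x ^ α * y ^ β * z ^ γ by ring]
  · have := pow_mul_pow_mul_pow_le_of_le (show γ + β + α = q by omega) hγ hx hxy hyz
    linarith [show z ^ γ * y ^ β * x ^ α = x ^ α * y ^ β * z ^ γ by ring]
  · have := pow_mul_pow_mul_pow_le_of_le (show β + γ + α = q by omega) hβ hx hxz hyz
    linarith [show y ^ β * z ^ γ * x ^ α = x ^ α * y ^ β * z ^ γ by ring]
  · have := pow_mul_pow_mul_pow_le_of_le (show β + α + γ = q by omega) hβ hz hxz hxy
    linarith [show y ^ β * x ^ α * z ^ γ = x ^ α * y ^ β * z ^ γ by ring]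
  · have := pow_mul_pow_mul_pow_le_of_le (show γ + α + β = q by omega) hγ hy hxy hxz
    linarith [show z ^ γ * x ^ α * y ^ β = x ^ α * y ^ β * z ^ γ by ring]
  · have := pow_mul_pow_mul_pow_le_of_le (show α + γ + β = q by omega) hα hy hyz hxz
    linarith [show x ^ α * z ^ γ * y ^ β = x ^ α * y ^ β * z ^ γ by ring]
  · have := pow_mul_pow_mul_pow_le_of_le (show α + β + γ = q by omega) hα hz hyz hxy
    linarith
  · have := pow_mul_pow_mul_pow_le_of_le (show α + β + γ = q by omega) hα hz hyz hxy
    linarith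

lemma fourPoint_le {q : ℕ} (hq : 0 < q) {x y z : ℝ} (hx : 0 ≤ x) (hy : 0 ≤ y) (hz : 0 ≤ z) :
    fourPoint q x y z ≤ (q.factorial : ℝ) ^ 2 * (x ^ q + y ^ q + z ^ q) +
      (∑ p ∈ fourPointIndex q, fourPointCoeff q p) * (x ^ (q - 1) * y + y ^ (q - 1) * x +
        x ^ (q - 1) * z + z ^ (q - 1) * x + y ^ (q - 1) * z + z ^ (q - 1) * y) := by
  rw [fourPoint_eq_add hq]
  refine add_le_add le_rfl ?_
  rw [Finset.sum_mul]
  refine le_trans (Finset.sum_le_sum fun p hp => ?_) (Finset.sum_le_sum_of_subset_of_nonneg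
    Finset.sdiff_subset fun p _ _ => mul_nonneg (fourPointCoeff_nonneg q p) (by positivity))
  obtain ⟨k, l⟩ := p
  simp only [fourPointIndex, Finset.mem_sdiff, Finset.mem_sigma, Finset.mem_range,
    Finset.mem_insert, Finset.mem_singleton, Sigma.mk.injEq, heq_eq_eq, not_or] at hp
  exact mul_le_mul_of_nonneg_left (pow_mul_pow_mul_pow_le (α := q - k) (β := k - l) (γ := l)
    (by omega) (by omega) (by omega) (by omega) hx hy hz) (fourPointCoeff_nonneg q _)

/-! ### Moments and cumulants of Hermite sums -/

section SumMoments

variable {Ω T : Type*} [MeasurableSpace Ω] {P : Measure Ω} [IsProbabilityMeasure P]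
  {f : T → Ω → ℝ} {s : Finset T}

lemma integral_sum_mul_of_hasAllMoments {g : Ω → ℝ} (hf : ∀ t, HasAllMoments (f t) P)
    (hg : HasAllMoments g P) :
    ∫ ω, (∑ t ∈ s, f t ω) * g ω ∂P = ∑ t ∈ s, ∫ ω, f t ω * g ω ∂P := by
  simp_rw [Finset.sum_mul]
  exact integral_finsetSum _ fun t _ => ((hf t).mul hg).integrable

lemma integral_sum_sq_of_hasAllMoments (hf : ∀ t, HasAllMoments (f t) P) :
    ∫ ω, (∑ t ∈ s, f t ω) ^ 2 ∂P = ∑ i ∈ s, ∑ j ∈ s, ∫ ω, f i ω * f j ω ∂P := by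
  have hS : HasAllMoments (fun ω => ∑ t ∈ s, f t ω) P := .finset_sum s fun t _ => hf t
  simp_rw [pow_two]
  rw [integral_sum_mul_of_hasAllMoments hf hS]
  refine Finset.sum_congr rfl fun i _ => ?_
  simp_rw [mul_comm (f i _)]
  rw [integral_sum_mul_of_hasAllMoments hf (hf i)]

lemma integral_sum_cube_of_hasAllMoments (hf : ∀ t, HasAllMoments (f t) P) :
    ∫ ω, (∑ t ∈ s, f t ω) ^ 3 ∂P =
      ∑ i ∈ s, ∑ j ∈ s, ∑ k ∈ s, ∫ ω, f i ω * (f j ω * f k ω) ∂P := by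
  have hS : HasAllMoments (fun ω => ∑ t ∈ s, f t ω) P := .finset_sum s fun t _ => hf t
  have e (x : ℝ) : x ^ 3 = x * (x * x) := by ring
  simp_rw [e]
  rw [integral_sum_mul_of_hasAllMoments hf (hS.mul hS)]
  refine Finset.sum_congr rfl fun i _ => ?_
  simp_rw [mul_left_comm (f i _)]
  rw [integral_sum_mul_of_hasAllMoments hf ((hf i).mul hS)]
  refine Finset.sum_congr rfl fun j _ => ?_
  simp_rw [← mul_assoc, mul_comm _ (∑ t ∈ s, f t _)]
  rw [integral_sum_mul_of_hasAllMoments hf ((hf j).mul (hf i))]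
  exact Finset.sum_congr rfl fun k _ => by congr 1; ext ω; ring

lemma integral_sum_pow_four_of_hasAllMoments (hf : ∀ t, HasAllMoments (f t) P) :
    ∫ ω, (∑ t ∈ s, f t ω) ^ 4 ∂P =
      ∑ i ∈ s, ∑ j ∈ s, ∑ k ∈ s, ∑ l ∈ s, ∫ ω, f i ω * (f j ω * (f k ω * f l ω)) ∂P := by
  have hS : HasAllMoments (fun ω => ∑ t ∈ s, f t ω) P := .finset_sum s fun t _ => hf t
  have e (x : ℝ) : x ^ 4 = x * (x * (x * x)) := by ring
  simp_rw [e]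
  rw [integral_sum_mul_of_hasAllMoments hf (hS.mul (hS.mul hS))]
  refine Finset.sum_congr rfl fun i _ => ?_
  simp_rw [mul_left_comm (f i _)]
  rw [integral_sum_mul_of_hasAllMoments hf (hS.mul ((hf i).mul hS))]
  refine Finset.sum_congr rfl fun j _ => ?_
  simp_rw [mul_left_comm (f j _)]
  rw [integral_sum_mul_of_hasAllMoments hf ((hf i).mul ((hf j).mul hS))]
  refine Finset.sum_congr rfl fun k _ => ?_
  simp_rw [← mul_assoc, mul_comm _ (∑ t ∈ s, f t _)]
  rw [integral_sum_mul_of_hasAllMoments hf (((hf k).mul (hf i)).mul (hf j))]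
  exact Finset.sum_congr rfl fun l _ => by congr 1; ext ω; ring

end SumMoments

namespace IsStandardGaussianFamily

variable {Ω T : Type*} [MeasurableSpace Ω] {X : T → Ω → ℝ} {ρ : T → T → ℝ} {P : Measure Ω}

/-- Each pure power splits the quadruple sum into a square of a double sum. These are the terms that
the fourth cumulant subtracts. -/
lemma three_mul_variance_sq (h : IsStandardGaussianFamily X ρ P) (q : ℕ) (s : Finset T) :
    3 * (q.factorial * ∑ i ∈ s, ∑ j ∈ s, ρ i j ^ q) ^ 2 =
      pairingSum s ρ (fun x y z => (q.factorial : ℝ) ^ 2 * (x ^ q + y ^ q + z ^ q)) := by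
  have e2 : pairingSum s ρ (fun _ y _ => y ^ q) = pairingSum s ρ (fun x _ _ => x ^ q) :=
    pairingSum_swap_left h.symm (fun x _ _ => x ^ q)
  have e3 : pairingSum s ρ (fun _ _ z => z ^ q) = pairingSum s ρ (fun _ y _ => y ^ q) :=
    pairingSum_swap_right h.symm (fun _ y _ => y ^ q)
  rw [pairingSum_const_mul ((q.factorial : ℝ) ^ 2) (fun x y z => x ^ q + y ^ q + z ^ q),
    pairingSum_add (fun x y _ => x ^ q + y ^ q) (fun _ _ z => z ^ q),
    pairingSum_add (fun x _ _ => x ^ q) (fun _ y _ => y ^ q), e3, e2, pairingSum_left_pow]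
  ring

lemma sum_sq_le_fourth_cumulant (h : IsStandardGaussianFamily X ρ P) (h0 : ∀ i j, 0 ≤ ρ i j)
    (h1 : ∀ i j, ρ i j ≤ 1) {q : ℕ} (hq : 2 ≤ q) (s : Finset T) :
    ∑ i ∈ s, ∑ k ∈ s, ρ i k ^ 2 ≤ pairingSum s ρ (fourPoint q) -
      3 * (q.factorial * ∑ i ∈ s, ∑ j ∈ s, ρ i j ^ q) ^ 2 := by
  rw [h.three_mul_variance_sq, le_sub_iff_add_le']
  refine (add_le_add le_rfl (sum_sq_le_pairingSum h0 h.diag (q - 1))).trans ?_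
  rw [← pairingSum_add]
  exact pairingSum_mono h0 h1 fun x y z hx hy hz => le_fourPoint hq hx.1 hy.1 hz.1

lemma fourth_cumulant_le (h : IsStandardGaussianFamily X ρ P) (h0 : ∀ i j, 0 ≤ ρ i j)
    (h1 : ∀ i j, ρ i j ≤ 1) {q : ℕ} (hq : 0 < q) (s : Finset T) {G : ℝ}
    (hG : ∀ i, ∑ j ∈ s, ρ i j ^ (q - 1) ≤ G) :
    pairingSum s ρ (fourPoint q) - 3 * (q.factorial * ∑ i ∈ s, ∑ j ∈ s, ρ i j ^ q) ^ 2 ≤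
      6 * (∑ p ∈ fourPointIndex q, fourPointCoeff q p) *
        (G ^ 2 * ∑ i ∈ s, ∑ k ∈ s, ρ i k ^ 2) := by
  have hC : 0 ≤ ∑ p ∈ fourPointIndex q, fourPointCoeff q p :=
    Finset.sum_nonneg fun p _ => fourPointCoeff_nonneg q p
  have hb := pairingSum_le h.symm h0 hG
  have hle := pairingSum_mono (s := s) h0 h1
    (fun x y z hx hy hz => fourPoint_le hq (x := x) (y := y) (z := z) hx.1 hy.1 hz.1)
  set S := pairingSum s ρ (fun x y _ => x ^ (q - 1) * y)
  have e1 : pairingSum s ρ (fun x y _ => y ^ (q - 1) * x) = S :=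
    pairingSum_swap_left h.symm (fun x y _ => x ^ (q - 1) * y)
  have e2 : pairingSum s ρ (fun x _ z => x ^ (q - 1) * z) = S :=
    pairingSum_swap_right h.symm (fun x y _ => x ^ (q - 1) * y)
  have e3 : pairingSum s ρ (fun x _ z => z ^ (q - 1) * x) = S :=
    (pairingSum_swap_right h.symm (fun x y _ => y ^ (q - 1) * x)).trans e1
  have e4 : pairingSum s ρ (fun _ y z => y ^ (q - 1) * z) = S :=
    (pairingSum_swap_left h.symm (fun x _ z => x ^ (q - 1) * z)).trans e2
  have e5 : pairingSum s ρ (fun _ y z => z ^ (q - 1) * y) = S :=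
    (pairingSum_swap_left h.symm (fun x _ z => z ^ (q - 1) * x)).trans e3
  rw [pairingSum_add (fun x y z => (q.factorial : ℝ) ^ 2 * (x ^ q + y ^ q + z ^ q)),
    ← h.three_mul_variance_sq, pairingSum_const_mul,
    pairingSum_add _ (fun _ y z => z ^ (q - 1) * y),
    pairingSum_add _ (fun _ y z => y ^ (q - 1) * z),
    pairingSum_add _ (fun x _ z => z ^ (q - 1) * x),
    pairingSum_add _ (fun x _ z => x ^ (q - 1) * z),
    pairingSum_add (fun x y _ => x ^ (q - 1) * y) (fun x y _ => y ^ (q - 1) * x),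
    e1, e2, e3, e4, e5] at hle
  nlinarith [mul_le_mul_of_nonneg_left hb hC]

variable [IsProbabilityMeasure P]

lemma hermite_sum_hasAllMoments (h : IsStandardGaussianFamily X ρ P) (q : ℕ) (s : Finset T) :
    HasAllMoments (fun ω => ∑ t ∈ s, (realHermite q).eval (X t ω)) P :=
  .finset_sum s fun t _ => h.hermite_hasAllMoments q t

lemma integral_hermite_sum (h : IsStandardGaussianFamily X ρ P) {q : ℕ} (hq : q ≠ 0)
    (s : Finset T) : ∫ ω, ∑ t ∈ s, (realHermite q).eval (X t ω) ∂P = 0 := by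
  rw [integral_finsetSum _ fun t _ => (h.hermite_hasAllMoments q t).integrable]
  exact Finset.sum_eq_zero fun t _ => h.integral_hermite hq t

lemma integral_hermite_sum_sq (h : IsStandardGaussianFamily X ρ P) (q : ℕ) (s : Finset T) :
    ∫ ω, (∑ t ∈ s, (realHermite q).eval (X t ω)) ^ 2 ∂P =
      q.factorial * ∑ i ∈ s, ∑ j ∈ s, ρ i j ^ q := by
  rw [integral_sum_sq_of_hasAllMoments (h.hermite_hasAllMoments q)]
  simp only [h.integral_hermite_two, if_true, Finset.mul_sum]

lemma integral_hermite_sum_cube_of_odd (h : IsStandardGaussianFamily X ρ P) {q : ℕ} (hq : Odd q)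
    (s : Finset T) : ∫ ω, (∑ t ∈ s, (realHermite q).eval (X t ω)) ^ 3 ∂P = 0 := by
  rw [integral_sum_cube_of_hasAllMoments (h.hermite_hasAllMoments q)]
  simp [h.integral_hermite_three_of_odd hq]

lemma integral_hermite_sum_cube (h : IsStandardGaussianFamily X ρ P) (p : ℕ) (s : Finset T) :
    ∫ ω, (∑ t ∈ s, (realHermite (p + p)).eval (X t ω)) ^ 3 ∂P =
      ((p + p).factorial / p.factorial : ℝ) ^ 3 *
        ∑ i ∈ s, ∑ j ∈ s, ∑ k ∈ s, (ρ j k * ρ i k * ρ i j) ^ p := by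
  rw [integral_sum_cube_of_hasAllMoments (h.hermite_hasAllMoments (p + p))]
  simp only [h.integral_hermite_three p p p, Finset.mul_sum, mul_pow, div_pow]
  refine Finset.sum_congr rfl fun i _ => Finset.sum_congr rfl fun j _ =>
    Finset.sum_congr rfl fun k _ => ?_
  ring

lemma integral_hermite_sum_pow_four (h : IsStandardGaussianFamily X ρ P) (q : ℕ) (s : Finset T) :
    ∫ ω, (∑ t ∈ s, (realHermite q).eval (X t ω)) ^ 4 ∂P = pairingSum s ρ (fourPoint q) := by
  rw [integral_sum_pow_four_of_hasAllMoments (h.hermite_hasAllMoments q)]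
  simp only [h.integral_hermite_four]
  rfl

end IsStandardGaussianFamily

section Normalized

variable {Ω : Type*} [MeasurableSpace Ω] {X : ℤ → Ω → ℝ} {ρ : ℕ → ℕ → ℝ} {P : Measure Ω}
  [IsProbabilityMeasure P]

/-- The cumulants of the normalized Hermite sum. -/
lemma IsStandardGaussianFamily.cumulant_normalizedHermiteSum
    (h : IsStandardGaussianFamily (fun k : ℕ => X k) ρ P) {q n : ℕ} (hq : q ≠ 0) (hn : n ≠ 0)
    {σ : ℝ} (hσ : σ = q.factorial * ∑ i ∈ Finset.range n, ∑ j ∈ Finset.range n, ρ i j ^ q)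
    (hpos : 0 < σ) :
    cumulant P 3 (normalizedHermiteSum P q X n) =
      (∫ ω, (∑ t ∈ Finset.range n, (realHermite q).eval (X t ω)) ^ 3 ∂P) / (σ * √σ) ∧
    cumulant P 4 (normalizedHermiteSum P q X n) =
      (pairingSum (Finset.range n) ρ (fourPoint q) - 3 * σ ^ 2) / σ ^ 2 := by
  set S : Ω → ℝ := fun ω => ∑ t ∈ Finset.range n, (realHermite q).eval (X t ω)
  have hS : HasAllMoments S P := h.hermite_sum_hasAllMoments q _
  have hS1 : ∫ ω, S ω ∂P = 0 := h.integral_hermite_sum hq _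
  have hS2 : ∫ ω, S ω ^ 2 ∂P = σ := by rw [hσ]; exact h.integral_hermite_sum_sq q _
  have hS4 : ∫ ω, S ω ^ 4 ∂P = pairingSum (Finset.range n) ρ (fourPoint q) :=
    h.integral_hermite_sum_pow_four q _
  have hn' : (0 : ℝ) < √(n : ℝ) := Real.sqrt_pos.2 (by positivity)
  have hV (ω : Ω) : hermiteSum q X n ω = 1 / √(n : ℝ) * S ω := by
    simp only [hermiteSum, S, aeval_hermite_eq_eval]
  -- The factor `1 / √n` cancels between the sum and its standard deviation.
  have hF : normalizedHermiteSum P q X n = fun ω => (√σ)⁻¹ * S ω := by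
    ext ω
    simp only [normalizedHermiteSum, hV, mul_pow]
    rw [integral_const_mul, hS2, Real.sqrt_mul (by positivity), Real.sqrt_sq (by positivity)]
    have : 0 < √σ := Real.sqrt_pos.2 hpos
    field_simp
  have hsq : √σ ^ 2 = σ := Real.sq_sqrt hpos.le
  obtain ⟨h3, h4⟩ := (hS.const_mul (√σ)⁻¹).cumulant_three_four
    (by rw [integral_const_mul, hS1, mul_zero])
  rw [hF, h3, h4]
  simp only [mul_pow, integral_const_mul, hS2, hS4]
  have e2 : (√σ)⁻¹ ^ 2 = σ⁻¹ := by rw [inv_pow, hsq]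
  have e3 : (√σ)⁻¹ ^ 3 = (σ * √σ)⁻¹ := by rw [inv_pow, pow_succ, hsq]
  have e4 : (√σ)⁻¹ ^ 4 = (σ ^ 2)⁻¹ := by rw [inv_pow, ← hsq, ← pow_mul]; simp [hsq]
  rw [e2, e3, e4]
  constructor
  · rw [div_eq_inv_mul]
  · field_simp

end Normalized

/-! ### The covariance of fractional Gaussian noise -/

/-- Second differences of `x ↦ x ^ p` by the mean value theorem. -/
lemma exists_second_difference_rpow {p x : ℝ} (hp : 1 < p) (hx : 1 ≤ x) :
    ∃ y ∈ Set.Ioo (x - 1) (x + 1),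
      (x + 1) ^ p + (x - 1) ^ p - 2 * x ^ p = p * (p - 1) * y ^ (p - 2) := by
  have hc : Continuous fun y : ℝ => y ^ p := Real.continuous_rpow_const (by linarith)
  obtain ⟨ξ, hξ, h1⟩ := exists_hasDerivAt_eq_slope (fun y => (y + 1) ^ p - y ^ p)
    (fun y => p * (y + 1) ^ (p - 1) - p * y ^ (p - 1)) (show x - 1 < x by linarith)
    ((hc.comp (by fun_prop)).sub hc).continuousOn (fun y _ => by
      have h2 := (Real.hasDerivAt_rpow_const (x := y + 1) (p := p) (Or.inr hp.le)).comp_add_const y 1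
      exact h2.sub (Real.hasDerivAt_rpow_const (Or.inr hp.le)))
  have hξ0 : 0 < ξ := by linarith [hξ.1]
  obtain ⟨y, hy, h3⟩ := exists_hasDerivAt_eq_slope (fun y => p * y ^ (p - 1))
    (fun y => p * ((p - 1) * y ^ (p - 1 - 1))) (show ξ < ξ + 1 by linarith)
    (by
      have : Continuous fun y : ℝ => y ^ (p - 1) := Real.continuous_rpow_const (by linarith)
      fun_prop) (fun y hy =>
      (Real.hasDerivAt_rpow_const (Or.inl (by linarith [hy.1]))).const_mul p)
  refine ⟨y, ⟨by linarith [hy.1, hξ.1], by linarith [hy.2, hξ.2]⟩, ?_⟩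
  have e : p - 1 - 1 = p - 2 := by ring
  rw [e] at h3
  have e1 : x - (x - 1) = 1 := by ring
  have e2 : ξ + 1 - ξ = 1 := by ring
  have e3 : x - 1 + 1 = x := by ring
  rw [e1, div_one, e3] at h1
  rw [e2, div_one] at h3
  linear_combination -h1 - h3

/-- The covariance function of fractional Gaussian noise with Hurst index `H`. -/
noncomputable def noiseCovariance (H : ℝ) (k : ℤ) : ℝ :=
  (|(k : ℝ) + 1| ^ (2 * H) + |(k : ℝ) - 1| ^ (2 * H) - 2 * |(k : ℝ)| ^ (2 * H)) / 2

lemma noiseCovariance_neg (H : ℝ) (k : ℤ) : noiseCovariance H (-k) = noiseCovariance H k := by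
  have h1 : |(-(k : ℝ)) + 1| = |(k : ℝ) - 1| := by rw [← abs_neg]; congr 1; ring
  have h2 : |(-(k : ℝ)) - 1| = |(k : ℝ) + 1| := by rw [← abs_neg]; congr 1; ring
  simp only [noiseCovariance, Int.cast_neg, h1, h2, abs_neg]
  ring

lemma noiseCovariance_zero {H : ℝ} (hH : 0 < H) : noiseCovariance H 0 = 1 := by
  simp [noiseCovariance, Real.zero_rpow (show 2 * H ≠ 0 by positivity)]

lemma noiseCovariance_natAbs (H : ℝ) (k : ℤ) :
    noiseCovariance H k = noiseCovariance H (k.natAbs : ℤ) := by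
  rcases Int.natAbs_eq k with h | h
  · rw [← h]
  · conv_lhs => rw [h]
    rw [noiseCovariance_neg]

lemma exists_noiseCovariance_eq {H : ℝ} (hH : 1 / 2 < H) {k : ℕ} (hk : 1 ≤ k) :
    ∃ y ∈ Set.Ioo ((k : ℝ) - 1) (k + 1),
      noiseCovariance H k = H * (2 * H - 1) * y ^ (2 * H - 2) := by
  have hk' : (1 : ℝ) ≤ k := by exact_mod_cast hk
  obtain ⟨y, hy, h⟩ := exists_second_difference_rpow (p := 2 * H) (x := k) (by linarith) hk'
  refine ⟨y, hy, ?_⟩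
  rw [noiseCovariance, Int.cast_natCast, abs_of_nonneg (by linarith : (0 : ℝ) ≤ k + 1),
    abs_of_nonneg (by linarith : (0 : ℝ) ≤ (k : ℝ) - 1), abs_of_nonneg (by linarith : (0 : ℝ) ≤ k), h]
  ring

/-- The mean value point lies below `|k| + 1` and the exponent is negative. The shift by one also
makes the bound meaningful at `k = 0`. -/
lemma le_noiseCovariance {H : ℝ} (hH : 1 / 2 < H) (hH1 : H < 1) (k : ℤ) :
    H * (2 * H - 1) * ((k.natAbs : ℝ) + 1) ^ (2 * H - 2) ≤ noiseCovariance H k := by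
  have hc : 0 ≤ H * (2 * H - 1) := mul_nonneg (by linarith) (by linarith)
  rw [noiseCovariance_natAbs]
  rcases Nat.eq_zero_or_pos k.natAbs with h0 | h0
  · rw [h0]
    simp only [Nat.cast_zero, zero_add, Real.one_rpow, mul_one]
    rw [noiseCovariance_zero (by linarith)]
    nlinarith
  · obtain ⟨y, hy, h⟩ := exists_noiseCovariance_eq hH h0
    rw [h]
    have h1 : (1 : ℝ) ≤ k.natAbs := by exact_mod_cast h0
    exact mul_le_mul_of_nonneg_left
      (Real.rpow_le_rpow_of_nonpos (by linarith [hy.1]) hy.2.le (by linarith)) hc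

lemma noiseCovariance_pos {H : ℝ} (hH : 1 / 2 < H) (hH1 : H < 1) (k : ℤ) :
    0 < noiseCovariance H k := by
  refine lt_of_lt_of_le ?_ (le_noiseCovariance hH hH1 k)
  have : 0 < 2 * H - 1 := by linarith
  positivity

lemma noiseCovariance_one_le {H : ℝ} (hH : 1 / 2 < H) (hH1 : H < 1) :
    noiseCovariance H 1 ≤ 1 := by
  have h : (2 : ℝ) ^ (2 * H) ≤ (2 : ℝ) ^ (2 : ℝ) :=
    Real.rpow_le_rpow_of_exponent_le (by norm_num) (by linarith)
  have h2 : (2 : ℝ) ^ (2 : ℝ) = 4 := by norm_num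
  have e : |(1 : ℝ) + 1| = 2 := by norm_num
  rw [noiseCovariance]
  simp only [Int.cast_one, e, sub_self, abs_zero, abs_one, Real.one_rpow,
    Real.zero_rpow (show 2 * H ≠ 0 by linarith)]
  linarith

lemma noiseCovariance_le_one {H : ℝ} (hH : 1 / 2 < H) (hH1 : H < 1) (k : ℤ) :
    noiseCovariance H k ≤ 1 := by
  rw [noiseCovariance_natAbs]
  obtain h0 | h0 | h0 : k.natAbs = 0 ∨ k.natAbs = 1 ∨ 2 ≤ k.natAbs := by omega
  · rw [h0]; exact (noiseCovariance_zero (by linarith)).le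
  · rw [h0]; exact noiseCovariance_one_le hH hH1
  · obtain ⟨y, hy, h⟩ := exists_noiseCovariance_eq hH (show 1 ≤ k.natAbs by omega)
    have h2 : (2 : ℝ) ≤ k.natAbs := by exact_mod_cast h0
    have hy1 : y ^ (2 * H - 2) ≤ 1 :=
      Real.rpow_le_one_of_one_le_of_nonpos (by linarith [hy.1]) (by linarith)
    have hc : 0 ≤ H * (2 * H - 1) := mul_nonneg (by linarith) (by linarith)
    rw [h]
    nlinarith

lemma noiseCovariance_le {H : ℝ} (hH : 1 / 2 < H) (hH1 : H < 1) {k : ℤ} (hk : k ≠ 0) :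
    noiseCovariance H k ≤ 4 * |(k : ℝ)| ^ (2 * H - 2) := by
  rw [noiseCovariance_natAbs]
  have hcast : |(k : ℝ)| = (k.natAbs : ℝ) := by
    rw [Nat.cast_natAbs]; push_cast; rfl
  rw [hcast]
  obtain h0 | h0 : k.natAbs = 1 ∨ 2 ≤ k.natAbs := by omega
  · rw [h0]
    have := noiseCovariance_one_le hH hH1
    simp only [Nat.cast_one, Real.one_rpow]
    linarith
  · obtain ⟨y, hy, h⟩ := exists_noiseCovariance_eq hH (show 1 ≤ k.natAbs by omega)
    have h2 : (2 : ℝ) ≤ k.natAbs := by exact_mod_cast h0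
    have hc : H * (2 * H - 1) ≤ 1 := by nlinarith
    have hc0 : 0 ≤ H * (2 * H - 1) := mul_nonneg (by linarith) (by linarith)
    -- For `|k| ≥ 2` the point `y` exceeds `|k| - 1 ≥ |k| / 2`; the constant 4 bounds `2 ^ (2 -
    -- 2H)`.
    have hy1 : y ^ (2 * H - 2) ≤ ((k.natAbs : ℝ) / 2) ^ (2 * H - 2) :=
      Real.rpow_le_rpow_of_nonpos (by linarith) (by linarith [hy.1]) (by linarith)
    have hy2 : ((k.natAbs : ℝ) / 2) ^ (2 * H - 2) ≤ 4 * (k.natAbs : ℝ) ^ (2 * H - 2) := by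
      rw [Real.div_rpow (by linarith) (by norm_num), div_eq_inv_mul,
        ← Real.rpow_neg (by norm_num)]
      have h4 : (2 : ℝ) ^ (-(2 * H - 2)) ≤ (2 : ℝ) ^ (2 : ℝ) :=
        Real.rpow_le_rpow_of_exponent_le (by norm_num) (by linarith)
      have h5 : (2 : ℝ) ^ (2 : ℝ) = 4 := by norm_num
      have h6 : 0 ≤ (k.natAbs : ℝ) ^ (2 * H - 2) := by positivity
      nlinarith
    have hy3 : 0 ≤ y ^ (2 * H - 2) := Real.rpow_nonneg (by linarith [hy.1]) _
    rw [h]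
    nlinarith

lemma summable_noiseCovariance_rpow {H : ℝ} (hH : 1 / 2 < H) (hH1 : H < 1) {a : ℝ} (ha : 0 ≤ a)
    (h : 1 < a * (2 - 2 * H)) : Summable fun k : ℤ => noiseCovariance H k ^ a := by
  have hs : Summable fun k : ℤ => (4 : ℝ) ^ a * |(k : ℝ)| ^ (-(a * (2 - 2 * H))) :=
    (Real.summable_abs_int_rpow h).mul_left _
  refine Summable.of_norm_bounded_eventually hs ?_
  filter_upwards [(Set.finite_singleton (0 : ℤ)).compl_mem_cofinite] with k hk
  have hk0 : k ≠ 0 := by simpa using hk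
  have hpos := noiseCovariance_pos hH hH1 k
  rw [Real.norm_of_nonneg (Real.rpow_nonneg hpos.le _)]
  calc noiseCovariance H k ^ a ≤ (4 * |(k : ℝ)| ^ (2 * H - 2)) ^ a :=
        Real.rpow_le_rpow hpos.le (noiseCovariance_le hH hH1 hk0) ha
    _ = _ := by
        rw [Real.mul_rpow (by norm_num) (by positivity), ← Real.rpow_mul (abs_nonneg _)]
        congr 2
        ring

lemma sum_range_comp_sub_le_tsum {g : ℤ → ℝ} (hg : Summable g) (h0 : ∀ k, 0 ≤ g k) (i n : ℕ) :
    ∑ j ∈ Finset.range n, g ((i : ℤ) - j) ≤ ∑' k, g k := by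
  have hinj : Function.Injective fun j : ℕ => (i : ℤ) - j := fun a b hab => by
    simp only at hab; omega
  calc ∑ j ∈ Finset.range n, g ((i : ℤ) - j) ≤ ∑' j : ℕ, g ((i : ℤ) - j) :=
        (hg.comp_injective hinj).sum_le_tsum _ fun j _ => h0 _
    _ ≤ ∑' k, g k := tsum_comp_le_tsum_of_inj hg h0 hinj

/-! ### Fractional Gaussian noise -/

lemma IsFractionalBrownianMotion.isStandardGaussianFamily {Ω : Type*} [MeasurableSpace Ω]
    {P : Measure Ω} {B : ℝ → Ω → ℝ} {H : ℝ} (hH : 0 < H)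
    (hB : IsFractionalBrownianMotion H B P) :
    IsStandardGaussianFamily (fun k : ℕ => unitIncrement B k)
      (fun i j => noiseCovariance H ((i : ℤ) - j)) P := by
  have hP := hB.gaussian.isProbabilityMeasure
  have hm (t : ℝ) : HasAllMoments (B t) P := fun m =>
    (hB.gaussian.hasGaussianLaw_eval t).memLp (by simp)
  have hi (s t : ℝ) : Integrable (fun ω => B s ω * B t ω) P := ((hm s).mul (hm t)).integrable
  have hi' (a b c d : ℝ) : Integrable (fun ω => B a ω * B b ω - B c ω * B d ω) P :=
    (hi a b).sub (hi c d)
  refine ⟨?_, ?_, ?_, ?_⟩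
  · refine hB.gaussian.of_isGaussianProcess fun k => ?_
    classical
    exact ⟨{((k : ℤ) : ℝ) + 1, ((k : ℤ) : ℝ)},
      { toFun x := x ⟨((k : ℤ) : ℝ) + 1, by simp⟩ - x ⟨((k : ℤ) : ℝ), by simp⟩
        map_add' x y := by simp; ring
        map_smul' c x := by simp; ring }, fun ω => by simp [unitIncrement]⟩
  · intro k
    simp only [unitIncrement]
    rw [integral_sub (hm _).integrable (hm _).integrable, hB.centered, hB.centered, sub_zero]
  · intro i j
    have e (ω : Ω) : unitIncrement B i ω * unitIncrement B j ω =
        (B ((i : ℝ) + 1) ω * B ((j : ℝ) + 1) ω - B ((i : ℝ) + 1) ω * B j ω) -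
          (B i ω * B ((j : ℝ) + 1) ω - B i ω * B j ω) := by
      simp only [unitIncrement, Int.cast_natCast]; ring
    simp_rw [e]
    rw [integral_sub (hi' _ _ _ _) (hi' _ _ _ _), integral_sub (hi _ _) (hi _ _),
      integral_sub (hi _ _) (hi _ _), hB.covariance, hB.covariance, hB.covariance, hB.covariance,
      noiseCovariance]
    have e1 : (i : ℝ) + 1 - (j + 1) = i - j := by ring
    have e2 : (i : ℝ) + 1 - j = i - j + 1 := by ring
    have e3 : (i : ℝ) - (j + 1) = i - j - 1 := by ring
    rw [e1, e2, e3]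
    push_cast
    ring
  · intro k
    simp [noiseCovariance_zero hH]

/-! ### Bounds for the cumulants of the Hermite sums of fractional Gaussian noise -/

/-- The sum of the squared covariances of the first `n` terms of fractional Gaussian noise. -/
noncomputable def sumSqCovariance (H : ℝ) (n : ℕ) : ℝ :=
  ∑ i ∈ Finset.range n, ∑ k ∈ Finset.range n, noiseCovariance H ((i : ℤ) - k) ^ 2

/-- All `n²` lags are below `n`, so each term is at least the bound for lag `n - 1`. -/
lemma le_sumSqCovariance {H : ℝ} (hH : 1 / 2 < H) (hH1 : H < 1) (n : ℕ) :
    (H * (2 * H - 1)) ^ 2 * ((n : ℝ) ^ 2 * (n : ℝ) ^ (4 * H - 4)) ≤ sumSqCovariance H n := by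
  have hc : 0 ≤ H * (2 * H - 1) := mul_nonneg (by linarith) (by linarith)
  have hterm : ∀ i ∈ Finset.range n, ∀ k ∈ Finset.range n,
      (H * (2 * H - 1)) ^ 2 * (n : ℝ) ^ (4 * H - 4) ≤ noiseCovariance H ((i : ℤ) - k) ^ 2 := by
    intro i hi k hk
    rw [Finset.mem_range] at hi hk
    have h1 : ((((i : ℤ) - k).natAbs : ℝ) + 1) ≤ n := by
      exact_mod_cast (show ((i : ℤ) - k).natAbs + 1 ≤ n by omega)
    have h2 : (n : ℝ) ^ (2 * H - 2) ≤ ((((i : ℤ) - k).natAbs : ℝ) + 1) ^ (2 * H - 2) :=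
      Real.rpow_le_rpow_of_nonpos (by positivity) h1 (by linarith)
    have h3 := (mul_le_mul_of_nonneg_left h2 hc).trans (le_noiseCovariance hH hH1 _)
    have h4 : (n : ℝ) ^ (4 * H - 4) = ((n : ℝ) ^ (2 * H - 2)) ^ 2 := by
      rw [← Real.rpow_natCast, ← Real.rpow_mul (by positivity)]
      congr 1
      push_cast
      ring
    rw [h4, ← mul_pow]
    exact pow_le_pow_left₀ (by positivity) h3 2
  calc (H * (2 * H - 1)) ^ 2 * ((n : ℝ) ^ 2 * (n : ℝ) ^ (4 * H - 4))
      = ∑ _i ∈ Finset.range n, ∑ _k ∈ Finset.range n,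
        (H * (2 * H - 1)) ^ 2 * (n : ℝ) ^ (4 * H - 4) := by
        simp only [Finset.sum_const, Finset.card_range, nsmul_eq_mul]; ring
    _ ≤ _ := Finset.sum_le_sum fun i hi => Finset.sum_le_sum fun k hk => hterm i hi k hk

lemma sumSqCovariance_le_of_summable {H : ℝ}
    (hs : Summable fun k : ℤ => noiseCovariance H k ^ 2) (n : ℕ) :
    sumSqCovariance H n ≤ (∑' k : ℤ, noiseCovariance H k ^ 2) * n := by
  calc sumSqCovariance H n ≤ ∑ _i ∈ Finset.range n, ∑' k : ℤ, noiseCovariance H k ^ 2 :=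
        Finset.sum_le_sum fun i _ => sum_range_comp_sub_le_tsum hs (fun k => sq_nonneg _) i n
    _ = _ := by simp [mul_comm]

lemma tendsto_sumSqCovariance_div {H : ℝ} (hH : 1 / 2 < H) (hH1 : H < 1) {m : ℕ}
    (hs : Summable fun k : ℤ => noiseCovariance H k ^ m) :
    Tendsto (fun n : ℕ => sumSqCovariance H n / (n : ℝ) ^ 2) atTop (𝓝 0) := by
  have hpos := noiseCovariance_pos hH hH1
  have hle := noiseCovariance_le_one hH hH1
  set G := ∑' k : ℤ, noiseCovariance H k ^ m
  have hbound (δ : ℝ) (hδ : 0 < δ) (n : ℕ) :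
      sumSqCovariance H n ≤ δ ^ 2 * (n : ℝ) ^ 2 + G / δ ^ m * n := by
    -- Split at level `δ`: small covariances contribute at most `δ²` each, and the large ones are
    -- counted by the summable `m`-th powers. Square summability, false for large `H`, is not
    -- needed.
    have hterm (k : ℤ) : noiseCovariance H k ^ 2 ≤ δ ^ 2 + noiseCovariance H k ^ m / δ ^ m := by
      have hk := hpos k
      rcases le_total (noiseCovariance H k) δ with h | h
      · have : 0 ≤ noiseCovariance H k ^ m / δ ^ m := by positivity
        have := pow_le_pow_left₀ hk.le h 2
        linarith
      · have h1 : 1 ≤ noiseCovariance H k ^ m / δ ^ m := by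
          rw [← div_pow]
          exact one_le_pow₀ ((one_le_div hδ).2 h)
        have h2 : noiseCovariance H k ^ 2 ≤ 1 := pow_le_one₀ hk.le (hle k)
        nlinarith [sq_nonneg δ]
    calc sumSqCovariance H n ≤ ∑ i ∈ Finset.range n, ∑ k ∈ Finset.range n,
          (δ ^ 2 + noiseCovariance H ((i : ℤ) - k) ^ m / δ ^ m) :=
          Finset.sum_le_sum fun i _ => Finset.sum_le_sum fun k _ => hterm _
      _ ≤ ∑ _i ∈ Finset.range n, (n * δ ^ 2 + G / δ ^ m) := by
          refine Finset.sum_le_sum fun i _ => ?_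
          rw [Finset.sum_add_distrib, ← Finset.sum_div]
          have := sum_range_comp_sub_le_tsum hs (fun k => pow_nonneg (hpos k).le m) i n
          simp only [Finset.sum_const, Finset.card_range, nsmul_eq_mul]
          gcongr
      _ = _ := by simp only [Finset.sum_const, Finset.card_range, nsmul_eq_mul]; ring
  have hnn (n : ℕ) : 0 ≤ sumSqCovariance H n / (n : ℝ) ^ 2 :=
    div_nonneg (Finset.sum_nonneg fun i _ => Finset.sum_nonneg fun k _ => sq_nonneg _)
      (sq_nonneg _)
  rw [Metric.tendsto_atTop]
  intro ε hε
  have hδ : 0 < √(ε / 2) := Real.sqrt_pos.2 (by positivity)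
  have hlim : Tendsto (fun n : ℕ => G / √(ε / 2) ^ m / (n : ℝ)) atTop (𝓝 0) :=
    tendsto_const_div_atTop_nhds_zero_nat _
  obtain ⟨N, hN⟩ := eventually_atTop.1
    ((hlim.eventually (gt_mem_nhds (show (0 : ℝ) < ε / 2 by positivity))).and
      (eventually_ge_atTop 1))
  refine ⟨N, fun n hn => ?_⟩
  obtain ⟨h1, h2⟩ := hN n hn
  have hn' : (0 : ℝ) < n := by exact_mod_cast h2
  rw [Real.dist_eq, sub_zero, abs_of_nonneg (hnn n)]
  have h3 := hbound _ hδ n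
  rw [Real.sq_sqrt (by positivity)] at h3
  calc sumSqCovariance H n / (n : ℝ) ^ 2
      ≤ (ε / 2 * (n : ℝ) ^ 2 + G / √(ε / 2) ^ m * n) / (n : ℝ) ^ 2 := by gcongr
    _ = ε / 2 + G / √(ε / 2) ^ m / n := by field_simp
    _ < ε := by linarith

/-- A triangular product is dominated by products over pairs of its edges. -/
lemma triple_pow_le {x y z : ℝ} (hx : 0 ≤ x) (hy : 0 ≤ y) (hz : 0 ≤ z) (p : ℕ) :
    (x * y * z) ^ p ≤ (x ^ (3 * p / 2 : ℝ) * y ^ (3 * p / 2 : ℝ) +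
      y ^ (3 * p / 2 : ℝ) * z ^ (3 * p / 2 : ℝ) + x ^ (3 * p / 2 : ℝ) * z ^ (3 * p / 2 : ℝ)) / 3 := by
  have h2 (x : ℝ) (hx : 0 ≤ x) : x ^ p = (x ^ (p / 2 : ℝ)) ^ 2 := by
    rw [← Real.rpow_natCast, ← Real.rpow_natCast, ← Real.rpow_mul hx]
    congr 1; push_cast; ring
  have h3 (x : ℝ) (hx : 0 ≤ x) : x ^ (3 * p / 2 : ℝ) = (x ^ (p / 2 : ℝ)) ^ 3 := by
    rw [← Real.rpow_natCast, ← Real.rpow_mul hx]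
    congr 1; push_cast; ring
  rw [mul_pow, mul_pow, h2 x hx, h2 y hy, h2 z hz, h3 x hx, h3 y hy, h3 z hz]
  have ha : 0 ≤ x ^ (p / 2 : ℝ) := Real.rpow_nonneg hx _
  have hb : 0 ≤ y ^ (p / 2 : ℝ) := Real.rpow_nonneg hy _
  have hc : 0 ≤ z ^ (p / 2 : ℝ) := Real.rpow_nonneg hz _
  generalize x ^ (p / 2 : ℝ) = a at *
  generalize y ^ (p / 2 : ℝ) = b at *
  generalize z ^ (p / 2 : ℝ) = c at *
  have key (u v w : ℝ) (hu : 0 ≤ u) (hv : 0 ≤ v) (hw : 0 ≤ w) :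
      u * v * w ≤ (u ^ 3 + v ^ 3 + w ^ 3) / 3 := by
    have : u ^ 3 + v ^ 3 + w ^ 3 - 3 * (u * v * w) =
        (u + v + w) * ((u - v) ^ 2 + (v - w) ^ 2 + (u - w) ^ 2) / 2 := by ring
    have : 0 ≤ (u + v + w) * ((u - v) ^ 2 + (v - w) ^ 2 + (u - w) ^ 2) / 2 := by positivity
    linarith
  -- With `a`, `b`, `c` the powers `p / 2`, the product of the three pairwise products is `a² b²
  -- c²`, and AM-GM returns their cubes.
  have := key (a * b) (b * c) (a * c) (by positivity) (by positivity) (by positivity)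
  calc a ^ 2 * b ^ 2 * c ^ 2 = a * b * (b * c) * (a * c) := by ring
    _ ≤ _ := this
    _ = _ := by ring

/-- Two edges of a triangle form a star. With its centre fixed, the sum over the two leaves factors
and is at most `U ^ 2`. -/
lemma sum_triple_le {T : Type*} {s : Finset T} {ρ : T → T → ℝ} (hρ : ∀ i j, ρ i j = ρ j i)
    (h0 : ∀ i j, 0 ≤ ρ i j) (p : ℕ) {U : ℝ} (hU : ∀ i, ∑ j ∈ s, ρ i j ^ (3 * p / 2 : ℝ) ≤ U) :
    ∑ i ∈ s, ∑ j ∈ s, ∑ k ∈ s, (ρ j k * ρ i k * ρ i j) ^ p ≤ U ^ 2 * s.card := by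
  set u : T → T → ℝ := fun i j => ρ i j ^ (3 * p / 2 : ℝ)
  have hu0 (i j : T) : 0 ≤ u i j := Real.rpow_nonneg (h0 i j) _
  have husymm (i j : T) : u i j = u j i := by simp only [u, hρ i j]
  have hnn (i : T) : 0 ≤ ∑ j ∈ s, u i j := Finset.sum_nonneg fun j _ => hu0 i j
  have hstar (f : T → T → T → ℝ)
      (hf : ∀ i, ∑ j ∈ s, ∑ k ∈ s, f i j k = (∑ j ∈ s, u i j) * ∑ k ∈ s, u i k) :
      ∑ i ∈ s, ∑ j ∈ s, ∑ k ∈ s, f i j k ≤ U ^ 2 * s.card := by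
    calc ∑ i ∈ s, ∑ j ∈ s, ∑ k ∈ s, f i j k ≤ ∑ _i ∈ s, U ^ 2 := by
          refine Finset.sum_le_sum fun i _ => ?_
          rw [hf, pow_two]
          exact mul_le_mul (hU i) (hU i) (hnn i) ((hnn i).trans (hU i))
      _ = _ := by rw [Finset.sum_const, nsmul_eq_mul, mul_comm]
  have s1 : ∑ i ∈ s, ∑ j ∈ s, ∑ k ∈ s, u j k * u i k ≤ U ^ 2 * s.card := by
    have : ∑ i ∈ s, ∑ j ∈ s, ∑ k ∈ s, u j k * u i k =
        ∑ k ∈ s, ∑ i ∈ s, ∑ j ∈ s, u j k * u i k := by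
      rw [Finset.sum_congr rfl fun i _ => Finset.sum_comm, Finset.sum_comm]
    rw [this]
    refine hstar (fun k i j => u j k * u i k) fun k => ?_
    rw [Finset.sum_mul_sum]
    exact Finset.sum_congr rfl fun i _ => Finset.sum_congr rfl fun j _ => by
      rw [husymm j k, husymm i k, mul_comm]
  have s2 : ∑ i ∈ s, ∑ j ∈ s, ∑ k ∈ s, u i k * u i j ≤ U ^ 2 * s.card := by
    refine hstar (fun i j k => u i k * u i j) fun i => ?_
    rw [Finset.sum_mul_sum]
    exact Finset.sum_congr rfl fun j _ => Finset.sum_congr rfl fun k _ => mul_comm _ _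
  have s3 : ∑ i ∈ s, ∑ j ∈ s, ∑ k ∈ s, u j k * u i j ≤ U ^ 2 * s.card := by
    rw [Finset.sum_comm]
    refine hstar (fun j i k => u j k * u i j) fun j => ?_
    rw [Finset.sum_mul_sum]
    exact Finset.sum_congr rfl fun i _ => Finset.sum_congr rfl fun k _ => by
      rw [husymm i j, mul_comm]
  calc ∑ i ∈ s, ∑ j ∈ s, ∑ k ∈ s, (ρ j k * ρ i k * ρ i j) ^ p
      ≤ ∑ i ∈ s, ∑ j ∈ s, ∑ k ∈ s, (u j k * u i k + u i k * u i j + u j k * u i j) / 3 :=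
        Finset.sum_le_sum fun i _ => Finset.sum_le_sum fun j _ => Finset.sum_le_sum fun k _ =>
          triple_pow_le (h0 _ _) (h0 _ _) (h0 _ _) p
    _ = (∑ i ∈ s, ∑ j ∈ s, ∑ k ∈ s, u j k * u i k + ∑ i ∈ s, ∑ j ∈ s, ∑ k ∈ s, u i k * u i j +
          ∑ i ∈ s, ∑ j ∈ s, ∑ k ∈ s, u j k * u i j) / 3 := by
        simp only [← Finset.sum_div, Finset.sum_add_distrib]
    _ ≤ _ := by linarith

lemma card_le_sum_triple {T : Type*} {s : Finset T} {ρ : T → T → ℝ}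
    (h0 : ∀ i j, 0 ≤ ρ i j) (hd : ∀ i, ρ i i = 1) (p : ℕ) :
    (s.card : ℝ) ≤ ∑ i ∈ s, ∑ j ∈ s, ∑ k ∈ s, (ρ j k * ρ i k * ρ i j) ^ p := by
  have hn (i j k : T) : 0 ≤ (ρ j k * ρ i k * ρ i j) ^ p :=
    pow_nonneg (mul_nonneg (mul_nonneg (h0 _ _) (h0 _ _)) (h0 _ _)) _
  calc (s.card : ℝ) = ∑ _i ∈ s, 1 := by simp
    _ ≤ _ := by
      refine Finset.sum_le_sum fun i hi => ?_
      refine le_trans ?_ (Finset.single_le_sum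
        (f := fun j => ∑ k ∈ s, (ρ j k * ρ i k * ρ i j) ^ p)
        (fun j _ => Finset.sum_nonneg fun k _ => hn i j k) hi)
      refine le_trans ?_ (Finset.single_le_sum
        (f := fun k => (ρ i k * ρ i k * ρ i i) ^ p) (fun k _ => hn i i k) hi)
      simp [hd]

lemma fourth_cumulant_quotient_bounds {n σ V K R A C : ℝ} (hn : 0 < n) (hA : 0 < A) (hC : 0 ≤ C)
    (hR : 0 ≤ R) (h1 : n ≤ σ) (h2 : σ ≤ A * n) (hK1 : R ≤ K) (hK2 : K ≤ C * R)
    (hV : V = K / σ ^ 2) :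
    (A ^ 2)⁻¹ * (R / n ^ 2) ≤ V ∧ V ≤ C * (R / n ^ 2) := by
  have hσ : 0 < σ := hn.trans_le h1
  subst hV
  constructor
  · calc (A ^ 2)⁻¹ * (R / n ^ 2) = R / (A * n) ^ 2 := by field_simp
      _ ≤ K / σ ^ 2 := by
        have : 0 ≤ K := hR.trans hK1
        gcongr
  · calc K / σ ^ 2 ≤ C * R / n ^ 2 := by gcongr
      _ = _ := by ring

/-- Two-sided bounds for the third and fourth cumulants of the normalized Hermite sums of
fractional Gaussian noise with positive correlations. -/
theorem noiseCumulant_bounds {Ω : Type*} [MeasurableSpace Ω] {P : Measure Ω}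
    [IsProbabilityMeasure P] {B : ℝ → Ω → ℝ} {H : ℝ} (hH : 1 / 2 < H) (hH1 : H < 1)
    (hB : IsFractionalBrownianMotion H B P) {q : ℕ} (hq : 2 ≤ q)
    (hs : Summable fun k : ℤ => noiseCovariance H k ^ (q - 1))
    (hs' : Summable fun k : ℤ => noiseCovariance H k ^ (3 * q / 4 : ℝ)) :
    ∃ a C : ℝ, 0 < a ∧ 0 < C ∧ ∀ n : ℕ, 1 ≤ n →
      |noiseCumulant P q B 3 n| ≤ C * (√(n : ℝ))⁻¹ ∧
      (Even q → a * (√(n : ℝ))⁻¹ ≤ noiseCumulant P q B 3 n) ∧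
      a * (sumSqCovariance H n / (n : ℝ) ^ 2) ≤ noiseCumulant P q B 4 n ∧
      noiseCumulant P q B 4 n ≤ C * (sumSqCovariance H n / (n : ℝ) ^ 2) := by
  have hX := hB.isStandardGaussianFamily (show 0 < H by linarith)
  set ρ : ℕ → ℕ → ℝ := fun i j => noiseCovariance H ((i : ℤ) - j)
  have hpos (i j : ℕ) : 0 < ρ i j := noiseCovariance_pos hH hH1 _
  have h0 (i j : ℕ) : 0 ≤ ρ i j := (hpos i j).le
  have h1 (i j : ℕ) : ρ i j ≤ 1 := noiseCovariance_le_one hH hH1 _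
  have hc0 (k : ℤ) : 0 ≤ noiseCovariance H k := (noiseCovariance_pos hH hH1 k).le
  set G := ∑' k : ℤ, noiseCovariance H k ^ (q - 1)
  set U := ∑' k : ℤ, noiseCovariance H k ^ (3 * q / 4 : ℝ)
  have hG (n i : ℕ) : ∑ j ∈ Finset.range n, ρ i j ^ (q - 1) ≤ G :=
    sum_range_comp_sub_le_tsum hs (fun k => pow_nonneg (hc0 k) _) i n
  have hU (n i : ℕ) : ∑ j ∈ Finset.range n, ρ i j ^ (3 * q / 4 : ℝ) ≤ U :=
    sum_range_comp_sub_le_tsum hs' (fun k => Real.rpow_nonneg (hc0 k) _) i n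
  have hG1 : 1 ≤ G := by
    have := hG 1 0
    simpa [hX.diag 0] using this
  set D := ∑ p ∈ fourPointIndex q, fourPointCoeff q p
  have hD : 0 ≤ D := Finset.sum_nonneg fun p _ => fourPointCoeff_nonneg q p
  have hf : (1 : ℝ) ≤ q.factorial := by exact_mod_cast Nat.factorial_pos q
  set A : ℝ := q.factorial * G
  have hA : 1 ≤ A := one_le_mul_of_one_le_of_one_le hf hG1
  set c3 : ℝ := (q.factorial / (q / 2).factorial : ℝ) ^ 3
  have hc3 : 0 < c3 := by positivity
  have hC4 : 0 ≤ 6 * D * G ^ 2 := by positivity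
  have hC3 : 0 ≤ c3 * U ^ 2 := by positivity
  refine ⟨min (A ^ 2)⁻¹ (c3 / (A * √A)), 6 * D * G ^ 2 + c3 * U ^ 2 + 1,
    lt_min (by positivity) (by positivity), by positivity, fun n hn => ?_⟩
  have hn' : (0 : ℝ) < n := by exact_mod_cast hn
  have hsqrt : 0 < √(n : ℝ) := Real.sqrt_pos.2 hn'
  obtain ⟨σ, hσ⟩ : ∃ σ : ℝ, σ = q.factorial * ∑ i ∈ Finset.range n, ∑ j ∈ Finset.range n,
    ρ i j ^ q := ⟨_, rfl⟩
  have hσ1 : (n : ℝ) ≤ σ := by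
    have : (n : ℝ) ≤ ∑ i ∈ Finset.range n, ∑ j ∈ Finset.range n, ρ i j ^ q := by
      calc (n : ℝ) = ∑ _i ∈ Finset.range n, 1 := by simp
        _ ≤ _ := by
          refine Finset.sum_le_sum fun i hi => ?_
          refine le_trans ?_ (Finset.single_le_sum (f := fun j => ρ i j ^ q)
            (fun j _ => pow_nonneg (h0 _ _) _) hi)
          simp [hX.diag i]
    rw [hσ]
    nlinarith
  have hσ2 : σ ≤ A * n := by
    have : ∑ i ∈ Finset.range n, ∑ j ∈ Finset.range n, ρ i j ^ q ≤ n * G := by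
      calc ∑ i ∈ Finset.range n, ∑ j ∈ Finset.range n, ρ i j ^ q
          ≤ ∑ _i ∈ Finset.range n, G := by
            refine Finset.sum_le_sum fun i _ => le_trans (Finset.sum_le_sum fun j _ => ?_) (hG n i)
            exact pow_le_pow_of_le_one (h0 _ _) (h1 _ _) (Nat.sub_le _ _)
        _ = n * G := by simp
    rw [hσ]
    calc _ ≤ (q.factorial : ℝ) * (n * G) := mul_le_mul_of_nonneg_left this (by positivity)
      _ = A * n := by ring
  have hσ0 : 0 < σ := hn'.trans_le hσ1
  obtain ⟨e3, e4⟩ := hX.cumulant_normalizedHermiteSum (X := unitIncrement B)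
    (show q ≠ 0 by omega) (show n ≠ 0 by omega) hσ hσ0
  have hR : 0 ≤ sumSqCovariance H n :=
    Finset.sum_nonneg fun i _ => Finset.sum_nonneg fun k _ => sq_nonneg _
  have hK1 := hX.sum_sq_le_fourth_cumulant h0 h1 hq (Finset.range n)
  have hK2 := hX.fourth_cumulant_le h0 h1 (by omega) (Finset.range n) (hG n)
  rw [← hσ] at hK1 hK2
  obtain ⟨b1, b2⟩ := fourth_cumulant_quotient_bounds (R := sumSqCovariance H n) (A := A)
    (C := 6 * D * G ^ 2) hn' (by positivity) hC4 hR hσ1 hσ2 hK1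
    (hK2.trans (le_of_eq (by rw [sumSqCovariance]; ring))) e4
  have hσs : √(n : ℝ) ≤ √σ := Real.sqrt_le_sqrt hσ1
  have hσs0 : 0 < √σ := Real.sqrt_pos.2 hσ0
  have hσs2 : √σ ≤ √A * √(n : ℝ) := by
    rw [← Real.sqrt_mul (by positivity)]; exact Real.sqrt_le_sqrt hσ2
  have hnn : 0 ≤ sumSqCovariance H n / (n : ℝ) ^ 2 := by positivity
  have hcard : ((Finset.range n).card : ℝ) = n := by simp
  have hthree : Even q → c3 * n / (σ * √σ) ≤ noiseCumulant P q B 3 n ∧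
      noiseCumulant P q B 3 n ≤ c3 * (U ^ 2 * n) / (σ * √σ) := by
    rintro ⟨p, rfl⟩
    have ep : (p + p) / 2 = p := by omega
    have ec : c3 = ((p + p).factorial / p.factorial : ℝ) ^ 3 := by simp only [c3, ep]
    have e3' := hX.integral_hermite_sum_cube p (Finset.range n)
    rw [← ec] at e3'
    rw [noiseCumulant, e3, e3']
    have hlow := card_le_sum_triple (s := Finset.range n) h0 hX.diag p
    have hupp := sum_triple_le (s := Finset.range n) hX.symm h0 p (U := U) (fun i => by
      -- Here `q = 2p`, so the exponent `3p/2` from AM-GM is the `3q/4` of the summability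
      -- hypothesis.
      have hexp : (3 * p / 2 : ℝ) = 3 * ((p + p : ℕ) : ℝ) / 4 := by push_cast; ring
      rw [hexp]
      exact hU n i)
    rw [hcard] at hlow hupp
    constructor <;> gcongr
  have hup : c3 * (U ^ 2 * n) / (σ * √σ) ≤ c3 * U ^ 2 * (√(n : ℝ))⁻¹ := by
    calc c3 * (U ^ 2 * n) / (σ * √σ) ≤ c3 * (U ^ 2 * n) / (n * √(n : ℝ)) := by gcongr
      _ = _ := by field_simp
  have hlo : c3 / (A * √A) * (√(n : ℝ))⁻¹ ≤ c3 * n / (σ * √σ) := by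
    calc c3 / (A * √A) * (√(n : ℝ))⁻¹ = c3 * n / ((A * n) * (√A * √(n : ℝ))) := by field_simp
      _ ≤ _ := by gcongr
  have hsi : 0 ≤ (√(n : ℝ))⁻¹ := by positivity
  refine ⟨?_, fun hev => ?_, ?_, ?_⟩
  · rcases Nat.even_or_odd q with hev | hodd
    · obtain ⟨t1, t2⟩ := hthree hev
      rw [abs_of_nonneg (le_trans (by positivity) t1)]
      refine (t2.trans hup).trans ?_
      nlinarith
    · rw [noiseCumulant, e3, hX.integral_hermite_sum_cube_of_odd hodd, zero_div, abs_zero]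
      positivity
  · refine le_trans ?_ (hlo.trans (hthree hev).1)
    exact mul_le_mul_of_nonneg_right (min_le_right _ _) hsi
  · exact (mul_le_mul_of_nonneg_right (min_le_left _ _) hnn).trans b1
  · refine le_trans b2 ?_
    nlinarith

/-! ### Comparison of the rates and the two Hurst intervals -/

lemma tendsto_const_mul_inv_sqrt (C : ℝ) :
    Tendsto (fun n : ℕ => C * (√(n : ℝ))⁻¹) atTop (𝓝 0) := by
  simpa using (tendsto_inv_atTop_zero.comp
    (Real.tendsto_sqrt_atTop.comp tendsto_natCast_atTop_atTop)).const_mul C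

lemma tendsto_inv_sqrt_div_rpow {H : ℝ} (hH : 7 / 8 < H) :
    Tendsto (fun n : ℕ => (√(n : ℝ))⁻¹ / (n : ℝ) ^ (4 * H - 4)) atTop (𝓝 0) := by
  have h := (tendsto_rpow_neg_atTop (show 0 < 4 * H - 7 / 2 by linarith)).comp
    (tendsto_natCast_atTop_atTop (R := ℝ))
  refine h.congr' ?_
  filter_upwards [eventually_ge_atTop 1] with n hn
  have hn' : (0 : ℝ) < n := by exact_mod_cast hn
  rw [Function.comp_apply, Real.sqrt_eq_rpow, ← Real.rpow_neg hn'.le, ← Real.rpow_sub hn']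
  congr 1
  ring

theorem corollary5p8 (q : ℕ) (hq : 6 ≤ q) :
    (∃ a b : ℝ, 0 < a ∧ a < b ∧ b ≤ 1 - 1 / (2 * (q : ℝ)) ∧
      ∀ H : ℝ, a < H → H < b →
      ∀ (Ω : Type*) [MeasurableSpace Ω] (P : Measure Ω) [IsProbabilityMeasure P]
        (B : ℝ → Ω → ℝ), IsFractionalBrownianMotion H B P →
        Tendsto (noiseCumulant P q B 3) atTop (𝓝 0) ∧
        Tendsto (noiseCumulant P q B 4) atTop (𝓝 0) ∧
        (∀ n : ℕ, 1 ≤ n → 0 < noiseCumulant P q B 4 n) ∧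
        noiseCumulant P q B 3 =o[atTop] noiseCumulant P q B 4) ∧
    (Even q → ∃ a b : ℝ, 0 < a ∧ a < b ∧ b ≤ 1 - 1 / (2 * (q : ℝ)) ∧
      ∀ H : ℝ, a < H → H < b →
      ∀ (Ω : Type*) [MeasurableSpace Ω] (P : Measure Ω) [IsProbabilityMeasure P]
        (B : ℝ → Ω → ℝ), IsFractionalBrownianMotion H B P →
        Tendsto (noiseCumulant P q B 3) atTop (𝓝 0) ∧
        Tendsto (noiseCumulant P q B 4) atTop (𝓝 0) ∧
        (∀ n : ℕ, 1 ≤ n → 0 < noiseCumulant P q B 3 n) ∧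
        noiseCumulant P q B 4 =o[atTop] noiseCumulant P q B 3) := by
  have hq6 : (6 : ℝ) ≤ q := by exact_mod_cast hq
  have hq0 : (0 : ℝ) < q := by linarith
  have hqc : ((q - 1 : ℕ) : ℝ) = q - 1 := by rw [Nat.cast_sub (by omega), Nat.cast_one]
  -- The bound on `H` says `(3q/4)(2 - 2H) > 1`; since `q - 1 ≥ 3q/4` for `q ≥ 4`, it also covers
  -- the exponent `q - 1`.
  have hsum (H : ℝ) (hH : 1 / 2 < H) (hHq : H < 1 - 2 / (3 * q)) : H < 1 ∧
      (Summable fun k : ℤ => noiseCovariance H k ^ (q - 1)) ∧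
      (Summable fun k : ℤ => noiseCovariance H k ^ (3 * q / 4 : ℝ)) := by
    have hlt : 2 / (3 * q) < 1 - H := by linarith
    rw [div_lt_iff₀ (by positivity)] at hlt
    have hH1 : H < 1 := by
      have : 0 < 2 / (3 * (q : ℝ)) := by positivity
      linarith
    refine ⟨hH1, ?_, summable_noiseCovariance_rpow hH hH1 (by positivity) (by nlinarith)⟩
    have := summable_noiseCovariance_rpow hH hH1 (a := ((q - 1 : ℕ) : ℝ)) (by positivity)
      (by rw [hqc]; nlinarith)
    simpa only [Real.rpow_natCast] using this
  constructor
  · refine ⟨7 / 8, 1 - 2 / (3 * q), by norm_num, ?_, ?_, ?_⟩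
    · have : 2 / (3 * (q : ℝ)) < 1 / 8 := by
        rw [div_lt_div_iff₀ (by positivity) (by norm_num)]; linarith
      linarith
    · have : 1 / (2 * (q : ℝ)) ≤ 2 / (3 * q) := by
        rw [div_le_div_iff₀ (by positivity) (by positivity)]; linarith
      linarith
    intro H hH hHq Ω _ P _ B hB
    have hH2 : 1 / 2 < H := by linarith
    obtain ⟨hH1, hs, hs'⟩ := hsum H hH2 hHq
    obtain ⟨a, C, ha, hC, hb⟩ := noiseCumulant_bounds hH2 hH1 hB (by omega) hs hs'
    set c : ℝ := a * (H * (2 * H - 1)) ^ 2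
    have hHc : 0 < 2 * H - 1 := by linarith
    have hc : 0 < c := by positivity
    have hlow (n : ℕ) (hn : 1 ≤ n) : c * (n : ℝ) ^ (4 * H - 4) ≤ noiseCumulant P q B 4 n := by
      have hn' : (0 : ℝ) < n := by exact_mod_cast hn
      refine le_trans ?_ (hb n hn).2.2.1
      rw [mul_assoc]
      refine mul_le_mul_of_nonneg_left ?_ ha.le
      rw [le_div_iff₀ (by positivity)]
      refine le_trans (le_of_eq ?_) (le_sumSqCovariance hH2 hH1 n)
      ring
    have hpos (n : ℕ) (hn : 1 ≤ n) : 0 < noiseCumulant P q B 4 n := by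
      have hn' : (0 : ℝ) < n := by exact_mod_cast hn
      exact lt_of_lt_of_le (by positivity) (hlow n hn)
    have hlim4 := (tendsto_sumSqCovariance_div hH2 hH1 hs).const_mul C
    rw [mul_zero] at hlim4
    refine ⟨?_, ?_, hpos, ?_⟩
    · refine squeeze_zero_norm' ?_ (tendsto_const_mul_inv_sqrt C)
      filter_upwards [eventually_ge_atTop 1] with n hn using (hb n hn).1
    · refine squeeze_zero' ?_ ?_ hlim4
      · filter_upwards [eventually_ge_atTop 1] with n hn using (hpos n hn).le
      · filter_upwards [eventually_ge_atTop 1] with n hn using (hb n hn).2.2.2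
    · rw [isLittleO_iff_tendsto' (by
        filter_upwards [eventually_ge_atTop 1] with n hn h using absurd h (hpos n hn).ne')]
      have hl := (tendsto_inv_sqrt_div_rpow hH).const_mul (C / c)
      rw [mul_zero] at hl
      refine squeeze_zero_norm' ?_ hl
      filter_upwards [eventually_ge_atTop 1] with n hn
      have hn' : (0 : ℝ) < n := by exact_mod_cast hn
      have hp := hpos n hn
      rw [norm_div, Real.norm_eq_abs, Real.norm_of_nonneg hp.le]
      calc |noiseCumulant P q B 3 n| / noiseCumulant P q B 4 n
          ≤ (C * (√(n : ℝ))⁻¹) / (c * (n : ℝ) ^ (4 * H - 4)) :=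
            div_le_div₀ (by positivity) (hb n hn).1 (by positivity) (hlow n hn)
        _ = _ := by rw [mul_div_mul_comm]
  · intro hev
    -- Above `1/2` covariances are positive; below `3/4` their squares are summable.
    refine ⟨1 / 2, 3 / 4, by norm_num, by norm_num, ?_, ?_⟩
    · have : 1 / (2 * (q : ℝ)) ≤ 1 / 4 := by
        rw [div_le_div_iff₀ (by positivity) (by norm_num)]; linarith
      linarith
    intro H hH hHq Ω _ P _ B hB
    have h34 : H < 1 - 2 / (3 * q) := by
      have : 2 / (3 * (q : ℝ)) ≤ 1 / 4 := by
        rw [div_le_div_iff₀ (by positivity) (by norm_num)]; linarith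
      linarith
    obtain ⟨hH1, hs, hs'⟩ := hsum H hH h34
    obtain ⟨a, C, ha, hC, hb⟩ := noiseCumulant_bounds hH hH1 hB (by omega) hs hs'
    have hs2 : Summable fun k : ℤ => noiseCovariance H k ^ 2 := by
      have := summable_noiseCovariance_rpow hH hH1 (a := ((2 : ℕ) : ℝ)) (by positivity)
        (by push_cast; linarith)
      simpa only [Real.rpow_natCast] using this
    set M := ∑' k : ℤ, noiseCovariance H k ^ 2
    have hM : 0 ≤ M := tsum_nonneg fun k => sq_nonneg _
    have hR (n : ℕ) : 0 ≤ sumSqCovariance H n / (n : ℝ) ^ 2 :=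
      div_nonneg (Finset.sum_nonneg fun i _ => Finset.sum_nonneg fun k _ => sq_nonneg _)
        (sq_nonneg _)
    have hnonneg (n : ℕ) (hn : 1 ≤ n) : 0 ≤ noiseCumulant P q B 4 n :=
      le_trans (mul_nonneg ha.le (hR n)) (hb n hn).2.2.1
    have hupp (n : ℕ) (hn : 1 ≤ n) : noiseCumulant P q B 4 n ≤ C * M * (n : ℝ)⁻¹ := by
      have hn' : (0 : ℝ) < n := by exact_mod_cast hn
      refine (hb n hn).2.2.2.trans ?_
      rw [mul_assoc]
      refine mul_le_mul_of_nonneg_left ?_ hC.le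
      rw [div_le_iff₀ (by positivity)]
      refine (sumSqCovariance_le_of_summable hs2 n).trans (le_of_eq ?_)
      change M * (n : ℝ) = M * (n : ℝ)⁻¹ * (n : ℝ) ^ 2
      field_simp
    have hpos (n : ℕ) (hn : 1 ≤ n) : 0 < noiseCumulant P q B 3 n := by
      have hn' : (0 : ℝ) < n := by exact_mod_cast hn
      exact lt_of_lt_of_le (by positivity) ((hb n hn).2.1 hev)
    have hlim4 := (tendsto_sumSqCovariance_div hH hH1 hs).const_mul C
    rw [mul_zero] at hlim4
    refine ⟨?_, ?_, hpos, ?_⟩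
    · refine squeeze_zero_norm' ?_ (tendsto_const_mul_inv_sqrt C)
      filter_upwards [eventually_ge_atTop 1] with n hn using (hb n hn).1
    · refine squeeze_zero' ?_ ?_ hlim4
      · filter_upwards [eventually_ge_atTop 1] with n hn using hnonneg n hn
      · filter_upwards [eventually_ge_atTop 1] with n hn using (hb n hn).2.2.2
    · rw [isLittleO_iff_tendsto' (by
        filter_upwards [eventually_ge_atTop 1] with n hn h using absurd h (hpos n hn).ne')]
      refine squeeze_zero_norm' ?_ (tendsto_const_mul_inv_sqrt (C * M / a))
      filter_upwards [eventually_ge_atTop 1] with n hn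
      have hn' : (0 : ℝ) < n := by exact_mod_cast hn
      have hsq : √(n : ℝ) * √(n : ℝ) = n := Real.mul_self_sqrt hn'.le
      have hs0 : 0 < √(n : ℝ) := Real.sqrt_pos.2 hn'
      rw [Real.norm_of_nonneg (div_nonneg (hnonneg n hn) (hpos n hn).le)]
      calc noiseCumulant P q B 4 n / noiseCumulant P q B 3 n
          ≤ (C * M * (n : ℝ)⁻¹) / (a * (√(n : ℝ))⁻¹) :=
            div_le_div₀ (by positivity) (hupp n hn) (by positivity) ((hb n hn).2.1 hev)
        _ = _ := by
          rw [show (n : ℝ)⁻¹ = (√(n : ℝ))⁻¹ * (√(n : ℝ))⁻¹ by rw [← mul_inv, hsq]]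
          field_simp
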